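/- Let $\Omega\subset\mathbb{R}^2$ be a domain (a nonempty connected open set) of finite Lebesgue measure. Let $f\in W^{2,1}(\Omega,\mathbb{R}^2)$ be a homeomorphism of $\Omega$ onto its image such that $J_f=\det Df>0$ almost everywhere in $\Omega$. Then for every $\nu>0$ there are closed squares $\{Q_i\}_{i=1}^{\infty}$ with sides parallel to the coordinate axes and positive side lengths, which are locally finite in $\Omega$ (i.e. each compact set $K\subset\Omega$ intersects only finitely many of them), with $$\mathcal{L}^2\Bigl(\bigcup_{i=1}^{\infty}Q_i\Bigr)<\nu,$$ and there is a $C^\infty$ diffeomorphism $g$ of the open set $\Omega\setminus\bigcup_{i=1}^{\infty}Q_i$ onto an open subset of $\mathbb{R}^2$ such that $$\|f-g\|_{W^{2,1}(\Omega\setminus\bigcup_{i=1}^{\infty}Q_i,\,\mathbb{R}^2)}<\nu.$$ Here $\|u\|_{W^{2,1}(U,\mathbb{R}^2)}=\int_U|u|+\int_U|Du|+\int_U|D^2u|$, where $Du$ and $D^2u$ are the weak first and second derivatives. -/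

import Mathlib

open MeasureTheory Set Topology
open scoped ENNReal ContDiff

set_option maxSynthPendingDepth 3

/-- The Euclidean plane. -/
abbrev Plane : Type := EuclideanSpace ℝ (Fin 2)

/-- `D : E → E →L[ℝ] F` is a weak (distributional) derivative of `u : E → F` in the open set `U`:
both maps are locally integrable in `U` and
`∫_U (∂_v φ) u = - ∫_U φ (D v)` for every direction `v` and every test function `φ ∈ C_c^∞(U)`.
Only the values of `u` and `D` in `U` matter. -/
structure HasWeakFDerivOn {E F : Type*} [NormedAddCommGroup E] [NormedSpace ℝ E]
    [MeasureSpace E] [NormedAddCommGroup F] [NormedSpace ℝ F]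
    (u : E → F) (D : E → E →L[ℝ] F) (U : Set E) : Prop where
  locallyIntegrable : LocallyIntegrableOn u U
  locallyIntegrable_deriv : LocallyIntegrableOn D U
  integral_eq : ∀ φ : E → ℝ, ContDiff ℝ ∞ φ → HasCompactSupport φ → tsupport φ ⊆ U →
    ∀ v : E, ∫ x in U, (fderiv ℝ φ x v) • u x = - ∫ x in U, φ x • D x v

/-- `u ∈ W^{2,1}(U, ℝ²)`: `u` has a weak gradient `D` and a weak second gradient `D2` in `U`,
and `u`, `D`, `D2` are integrable over `U`. -/
def MemW21 (u : Plane → Plane) (U : Set Plane) : Prop :=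
  ∃ (D : Plane → Plane →L[ℝ] Plane) (D2 : Plane → Plane →L[ℝ] Plane →L[ℝ] Plane),
    HasWeakFDerivOn u D U ∧ HasWeakFDerivOn D D2 U ∧
      IntegrableOn u U ∧ IntegrableOn D U ∧ IntegrableOn D2 U

/-- The norm `‖u‖_{W^{2,1}(U, ℝ²)} = ∫_U |u| + ∫_U |Du| + ∫_U |D²u|`, with value `∞` if `u` does
not belong to `W^{2,1}(U, ℝ²)`. Weak derivatives are unique up to null sets, so the infimum runs
over equal numbers, or over the empty set when `u` has no weak first and second derivative. -/
noncomputable def w21Norm (u : Plane → Plane) (U : Set Plane) : ℝ≥0∞ :=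
  ⨅ (D : Plane → Plane →L[ℝ] Plane) (D2 : Plane → Plane →L[ℝ] Plane →L[ℝ] Plane)
    (_ : HasWeakFDerivOn u D U) (_ : HasWeakFDerivOn D D2 U),
      (∫⁻ x in U, ‖u x‖ₑ) + (∫⁻ x in U, ‖D x‖ₑ) + ∫⁻ x in U, ‖D2 x‖ₑ

/-- The closed square with centre `c`, side length `2 * r` and sides parallel to the axes. -/
def square (c : Plane) (r : ℝ) : Set Plane := {x | ∀ j, |x j - c j| ≤ r}

/-! The map `g` is one mollification of `f` (extended by zero) at a sufficiently small scale.
Smoothness, and closeness in the norm away from the boundary, are standard (`fderiv_mollify`,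
`tendsto_setLIntegral_normed_convolution_sub`); the issue is injectivity off a small set.

On a compact `K` of almost full measure, keep the points where the mollified gradients are
invertible with a uniform bound and the means of `|D2|` over all discs are at most a constant
multiple of `m`. Almost every point of `K` qualifies for some `m`, by convergence of mollifications
and differentiation of measures (`exists_lt_measure_regularSet`). The mean bound survives
mollification with a constant independent of the scale
(`setLIntegral_normed_convolution_le_of_mean_bound`), and between two good points it gives a
quadratic Taylor remainder (`enorm_taylor_le_of_mean_bound`), although `D2` is merely integrable.

Thus nearby good points are separated because the linear term beats the remainder, at a distance
independent of the scale; distant good points are separated because `f` is injective and the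
mollifications converge uniformly on `K` (`eventually_separated_on_regularSet`). These estimates
pass to the compact closure `G` of the good set. Injectivity and invertibility of the gradient then
extend to an open `U ⊇ G`, and `Ω \ U`, relatively closed and of small measure, is covered by small
squares (`exists_locallyFinite_squares`). -/

open Filter Metric ContinuousLinearMap Convolution

/-! ### Weak derivatives: restriction, uniqueness, convolution -/

section WeakDerivative

variable {E F : Type*} [NormedAddCommGroup E] [NormedSpace ℝ E] [MeasureSpace E]
  [NormedAddCommGroup F] [NormedSpace ℝ F]

omit [NormedSpace ℝ E] in
lemma integrableOn_smul_of_tsupport_subset [BorelSpace E] {w : E → F} {U : Set E}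
    (hw : LocallyIntegrableOn w U) {φ : E → ℝ} (hφ : Continuous φ)
    (hc : HasCompactSupport φ) (hsub : tsupport φ ⊆ U) :
    IntegrableOn (fun x => φ x • w x) U := by
  have h1 : IntegrableOn w (tsupport φ) := hw.integrableOn_compact_subset hsub hc
  have h2 : IntegrableOn (fun x => φ x • w x) (tsupport φ) :=
    h1.continuousOn_smul_of_subset hφ.continuousOn hc (isClosed_tsupport φ).measurableSet subset_rfl
  exact ((integrableOn_iff_integrable_of_support_subset
    ((Function.support_smul_subset_left φ w).trans (subset_tsupport φ))).1 h2).integrableOn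

omit [NormedAddCommGroup E] [NormedSpace ℝ E] in
lemma setIntegral_eq_of_subset_of_tsupport {u : E → F} {U V : Set E} (hU : MeasurableSet U)
    (hV : MeasurableSet V) (hUV : U ⊆ V) (hu : Function.support u ⊆ U) :
    ∫ x in U, u x = ∫ x in V, u x := by
  rw [← integral_indicator hU, ← integral_indicator hV, indicator_eq_self.2 hu,
    indicator_eq_self.2 (hu.trans hUV)]

lemma HasWeakFDerivOn.mono [BorelSpace E] {u : E → F} {D : E → E →L[ℝ] F} {U V : Set E}
    (h : HasWeakFDerivOn u D V) (hU : IsOpen U) (hV : IsOpen V) (hUV : U ⊆ V) :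
    HasWeakFDerivOn u D U where
  locallyIntegrable := h.locallyIntegrable.mono_set hUV
  locallyIntegrable_deriv := h.locallyIntegrable_deriv.mono_set hUV
  integral_eq φ hφ hc hs v := by
    have := h.integral_eq φ hφ hc (hs.trans hUV) v
    rwa [← setIntegral_eq_of_subset_of_tsupport hU.measurableSet hV.measurableSet hUV,
      ← setIntegral_eq_of_subset_of_tsupport hU.measurableSet hV.measurableSet hUV] at this
    · exact (Function.support_smul_subset_left _ _).trans ((subset_tsupport φ).trans hs)
    · refine (Function.support_smul_subset_left _ _).trans (Subset.trans ?_ hs)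
      exact (subset_tsupport _).trans (tsupport_fderiv_apply_subset ℝ v)

lemma HasWeakFDerivOn.sub [BorelSpace E] {u u' : E → F} {D D' : E → E →L[ℝ] F} {U : Set E}
    (h : HasWeakFDerivOn u D U) (h' : HasWeakFDerivOn u' D' U) :
    HasWeakFDerivOn (fun x => u x - u' x) (fun x => D x - D' x) U where
  locallyIntegrable := h.locallyIntegrable.sub h'.locallyIntegrable
  locallyIntegrable_deriv := h.locallyIntegrable_deriv.sub h'.locallyIntegrable_deriv
  integral_eq φ hφ hc hs v := by
    have hφ' : Continuous fun x => fderiv ℝ φ x v :=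
      (hφ.continuous_fderiv (by simp)).clm_apply continuous_const
    have hc' : HasCompactSupport fun x => fderiv ℝ φ x v := hc.fderiv_apply ℝ v
    have hs' : tsupport (fun x => fderiv ℝ φ x v) ⊆ U := (tsupport_fderiv_apply_subset ℝ v).trans hs
    have i1 := integrableOn_smul_of_tsupport_subset h.locallyIntegrable hφ' hc' hs'
    have i2 := integrableOn_smul_of_tsupport_subset h'.locallyIntegrable hφ' hc' hs'
    have i3 := (integrableOn_smul_of_tsupport_subset h.locallyIntegrable_deriv
      hφ.continuous hc hs).apply_continuousLinearMap v
    have i4 := (integrableOn_smul_of_tsupport_subset h'.locallyIntegrable_deriv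
      hφ.continuous hc hs).apply_continuousLinearMap v
    simp only [FunLike.coe_smul, Pi.smul_apply] at i3 i4
    simp only [smul_sub, sub_apply]
    rw [integral_sub i1 i2, integral_sub i3 i4, h.integral_eq φ hφ hc hs v,
      h'.integral_eq φ hφ hc hs v]
    abel

lemma ContDiff.hasWeakFDerivOn [BorelSpace E] [FiniteDimensional ℝ E]
    [(volume : Measure E).IsAddHaarMeasure] {g : E → F} (hg : ContDiff ℝ 1 g)
    {U : Set E} (hU : IsOpen U) : HasWeakFDerivOn g (fderiv ℝ g) U where
  locallyIntegrable := hg.continuous.locallyIntegrable.locallyIntegrableOn U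
  locallyIntegrable_deriv :=
    (hg.continuous_fderiv one_ne_zero).locallyIntegrable.locallyIntegrableOn U
  integral_eq φ hφ hc hs v := by
    have hgd := hg.continuous_fderiv one_ne_zero
    have hφd : Continuous (fderiv ℝ φ) := hφ.continuous_fderiv (by simp)
    rw [setIntegral_eq_of_subset_of_tsupport hU.measurableSet MeasurableSet.univ (subset_univ _),
      setIntegral_eq_of_subset_of_tsupport hU.measurableSet MeasurableSet.univ (subset_univ _),
      Measure.restrict_univ]
    · have := integral_bilinear_hasLineDerivAt_right_eq_neg_left_of_integrable (μ := volume)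
        (f := φ) (f' := fun x => fderiv ℝ φ x v) (g := g) (g' := fun x => fderiv ℝ g x v) (v := v)
        (B := lsmul ℝ ℝ) ?_ ?_ ?_ ?_ ?_
      · simp only [lsmul_apply] at this
        rw [this, neg_neg]
      · exact Continuous.integrable_of_hasCompactSupport
          ((hφd.clm_apply continuous_const).smul hg.continuous) (hc.fderiv_apply ℝ v).smul_right
      · exact Continuous.integrable_of_hasCompactSupport
          (hφ.continuous.smul (hgd.clm_apply continuous_const)) hc.smul_right
      · exact Continuous.integrable_of_hasCompactSupport
          (hφ.continuous.smul hg.continuous) hc.smul_right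
      · exact fun x _ => ((hφ.differentiable (by simp)) x).hasFDerivAt.hasLineDerivAt v
      · exact fun x _ => ((hg.differentiable one_ne_zero) x).hasFDerivAt.hasLineDerivAt v
    · exact (Function.support_smul_subset_left _ _).trans ((subset_tsupport φ).trans hs)
    · refine (Function.support_smul_subset_left _ _).trans (Subset.trans ?_ hs)
      exact (subset_tsupport _).trans (tsupport_fderiv_apply_subset ℝ v)

lemma HasWeakFDerivOn.ae_eq [BorelSpace E] [FiniteDimensional ℝ E] [CompleteSpace F]
    {u : E → F} {D D' : E → E →L[ℝ] F} {U : Set E} (hU : IsOpen U)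
    (h : HasWeakFDerivOn u D U) (h' : HasWeakFDerivOn u D' U) :
    ∀ᵐ x ∂volume.restrict U, D x = D' x := by
  have key := hU.ae_eq_zero_of_integral_contDiff_smul_eq_zero (μ := volume)
    (f := fun x => D x - D' x) (h.locallyIntegrable_deriv.sub h'.locallyIntegrable_deriv) ?_
  · rw [ae_restrict_iff' hU.measurableSet]
    filter_upwards [key] with x hx hxU using sub_eq_zero.1 (hx hxU)
  · intro φ hφ hc hs
    have i3 := integrableOn_smul_of_tsupport_subset h.locallyIntegrable_deriv
      hφ.continuous hc hs
    have i4 := integrableOn_smul_of_tsupport_subset h'.locallyIntegrable_deriv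
      hφ.continuous hc hs
    have hsupp : Function.support (fun x => φ x • (D x - D' x)) ⊆ U :=
      (Function.support_smul_subset_left _ _).trans ((subset_tsupport φ).trans hs)
    rw [← Measure.restrict_univ (μ := (volume : Measure E)),
      ← setIntegral_eq_of_subset_of_tsupport hU.measurableSet MeasurableSet.univ (subset_univ _)
      hsupp]
    simp only [smul_sub]
    rw [integral_sub i3 i4, sub_eq_zero]
    ext v
    rw [ContinuousLinearMap.integral_apply i3, ContinuousLinearMap.integral_apply i4]
    have := h.integral_eq φ hφ hc hs v
    rw [h'.integral_eq φ hφ hc hs v] at this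
    simpa using this.symm

/-- The function `s ↦ ρ (x - s)` is an admissible test function because its support lies in `U`. The
sign from the reflection cancels the one in the definition of the weak derivative. -/
lemma HasWeakFDerivOn.fderiv_convolution [BorelSpace E] [FiniteDimensional ℝ E]
    [CompleteSpace F] [(volume : Measure E).IsAddHaarMeasure]
    {u : E → F} {D : E → E →L[ℝ] F} {U : Set E} (hU : IsOpen U)
    (h : HasWeakFDerivOn u D U) (hu : IntegrableOn u U) (hD : IntegrableOn D U)
    {ρ : E → ℝ} (hρ : ContDiff ℝ ∞ ρ) (hc : HasCompactSupport ρ) {x : E}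
    (hx : ∀ y ∈ tsupport ρ, x - y ∈ U) :
    fderiv ℝ (ρ ⋆[lsmul ℝ ℝ, volume] U.indicator u) x =
      (ρ ⋆[lsmul ℝ ℝ, volume] U.indicator D) x := by
  have hu' : LocallyIntegrable (U.indicator u) volume :=
    (hu.integrable_indicator hU.measurableSet).locallyIntegrable
  have hD' : LocallyIntegrable (U.indicator D) volume :=
    (hD.integrable_indicator hU.measurableSet).locallyIntegrable
  have hρ1 : ContDiff ℝ 1 ρ := hρ.of_le (by simp)
  rw [(hc.hasFDerivAt_convolution_left (lsmul ℝ ℝ) hρ1 hu' x).fderiv]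
  ext v
  set φ : E → ℝ := fun s => ρ (x - s) with hφdef
  have hφ : ContDiff ℝ ∞ φ := hρ.comp (contDiff_const.sub contDiff_id)
  have hcφ : HasCompactSupport φ := hc.comp_homeomorph (Homeomorph.subLeft x)
  have hsφ : tsupport φ ⊆ U := by
    have : tsupport φ ⊆ (fun s => x - s) ⁻¹' tsupport ρ :=
      tsupport_comp_subset_preimage ρ (continuous_const.sub continuous_id)
    intro s hs
    simpa using hx _ (this hs)
  have hdφ : ∀ s, fderiv ℝ φ s v = - fderiv ℝ ρ (x - s) v := by
    intro s
    have h1 : HasFDerivAt (fun s : E => x - s) (-ContinuousLinearMap.id ℝ E) s :=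
      (hasFDerivAt_id s).const_sub x
    have h2 := ((hρ1.differentiable one_ne_zero) (x - s)).hasFDerivAt.comp s h1
    have h3 : HasFDerivAt φ _ s := h2
    rw [h3.fderiv]; simp
  have key := h.integral_eq φ hφ hcφ hsφ v
  have e1 : ((fderiv ℝ ρ ⋆[(lsmul ℝ ℝ).precompL E, volume] U.indicator u) x) v
      = ∫ s, (fderiv ℝ ρ (x - s) v) • U.indicator u s := by
    rw [convolution_eq_swap, ContinuousLinearMap.integral_apply]
    · rfl
    · have := (hc.fderiv (𝕜 := ℝ)).convolutionExists_left ((lsmul ℝ ℝ).precompL E)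
        (hρ1.continuous_fderiv one_ne_zero) hu' x
      exact this.integrable_swap
  have e2 : ((ρ ⋆[lsmul ℝ ℝ, volume] U.indicator D) x) v
      = ∫ s, ρ (x - s) • (U.indicator D s) v := by
    rw [convolution_eq_swap, ContinuousLinearMap.integral_apply]
    · rfl
    · exact (hc.convolutionExists_left (lsmul ℝ ℝ) hρ1.continuous hD' x).integrable_swap
  rw [e1, e2]
  simp only [hdφ, neg_smul, integral_neg, neg_inj] at key
  rw [← integral_indicator hU.measurableSet, ← integral_indicator hU.measurableSet] at key
  convert key using 2
  · ext s; by_cases hs : s ∈ U <;> simp [hs]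
  · ext s; by_cases hs : s ∈ U <;> simp [hs, hφdef]

end WeakDerivative

/-! ### Taylor remainders controlled by means of the second derivative -/

section Taylor

variable {F : Type*} [NormedAddCommGroup F] [NormedSpace ℝ F]

/-- The segment integral bounds the variation of the gradient between `x` and every point of the
segment; the mean value inequality supplies the second factor `‖z - x‖`. The remainder is kept as an
integral so that it can be averaged over `z`. -/
lemma enorm_taylor_le {E : Type*} [NormedAddCommGroup E] [NormedSpace ℝ E] [CompleteSpace F]
    {u : E → F} (hu : ContDiff ℝ 2 u) (x z : E) :
    ‖u z - u x - fderiv ℝ u x (z - x)‖ₑ ≤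
      ∫⁻ t in Ioc (0 : ℝ) 1, ‖fderiv ℝ (fderiv ℝ u) (x + t • (z - x))‖ₑ * ‖z - x‖ₑ ^ 2 := by
  have hu1 : ContDiff ℝ 1 (fderiv ℝ u) := hu.fderiv_right (by norm_num)
  have hu2 : Continuous (fderiv ℝ (fderiv ℝ u)) := hu1.continuous_fderiv one_ne_zero
  set w := z - x with hw
  have hl : Continuous fun t : ℝ => x + t • w := by fun_prop
  set I := ∫⁻ t in Ioc (0 : ℝ) 1, ‖fderiv ℝ (fderiv ℝ u) (x + t • w)‖ₑ with hI
  have hItop : I ≠ ⊤ :=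
    (((hu2.comp hl).integrableOn_Icc (a := (0 : ℝ)) (b := 1)).mono_set
      Ioc_subset_Icc_self).hasFiniteIntegral.ne
  have hd : ∀ s ∈ Icc (0 : ℝ) 1,
      ‖fderiv ℝ u (x + s • w) - fderiv ℝ u x‖ₑ ≤ I * ‖w‖ₑ := by
    intro s hs
    have hder : ∀ t ∈ uIcc (0 : ℝ) s, HasDerivAt (fun t : ℝ => fderiv ℝ u (x + t • w))
        (fderiv ℝ (fderiv ℝ u) (x + t • w) w) t := by
      intro t _
      have h1 : HasDerivAt (fun t : ℝ => x + t • w) w t := by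
        simpa using ((hasDerivAt_id t).smul_const w).const_add x
      exact (hu1.differentiable one_ne_zero _).hasFDerivAt.comp_hasDerivAt t h1
    have hint := intervalIntegral.integral_eq_sub_of_hasDerivAt hder
      (((hu2.comp hl).clm_apply continuous_const).intervalIntegrable _ _)
    rw [zero_smul, add_zero] at hint
    rw [← hint, intervalIntegral.integral_of_le hs.1]
    refine (enorm_integral_le_lintegral_enorm _).trans ?_
    rw [hI, ← lintegral_mul_const' _ _ enorm_ne_top]
    refine (lintegral_mono_set (Ioc_subset_Ioc_right hs.2)).trans (lintegral_mono fun t => ?_)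
    exact le_opENorm _ _
  have hmv : ‖u z - u x - fderiv ℝ u x (z - x)‖ ≤ (I * ‖w‖ₑ).toReal * ‖z - x‖ := by
    refine (convex_segment x z).norm_image_sub_le_of_norm_fderiv_le' (𝕜 := ℝ)
      (fun y _ => hu.differentiable two_ne_zero y) ?_ (left_mem_segment ℝ x z)
      (right_mem_segment ℝ x z)
    intro y hy
    rw [segment_eq_image'] at hy
    obtain ⟨s, hs, rfl⟩ := hy
    have := ENNReal.toReal_mono (ENNReal.mul_ne_top hItop enorm_ne_top) (hd s hs)
    simpa using this
  have h2 := ENNReal.ofReal_le_ofReal hmv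
  rw [ofReal_norm, ENNReal.ofReal_mul ENNReal.toReal_nonneg,
    ENNReal.ofReal_toReal (ENNReal.mul_ne_top hItop enorm_ne_top), ofReal_norm] at h2
  refine h2.trans (le_of_eq ?_)
  rw [lintegral_mul_const' _ _ (ENNReal.pow_ne_top enorm_ne_top), ← hI, ← hw]
  ring

lemma setLIntegral_ball_homothety (G : Plane → ℝ≥0∞) (hG : Measurable G) (x : Plane)
    {R t : ℝ} (ht : 0 < t) :
    ∫⁻ z in ball x R, G (x + t • (z - x)) =
      ENNReal.ofReal (t ^ 2)⁻¹ * ∫⁻ z in ball x (t * R), G z := by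
  rw [← lintegral_indicator measurableSet_ball, ← lintegral_indicator measurableSet_ball]
  have e : ∀ z, (ball x R).indicator (fun z => G (x + t • (z - x))) z =
      (fun w => (ball x (t * R)).indicator G (x + t • w)) (z - x) := by
    intro z
    have : z ∈ ball x R ↔ x + t • (z - x) ∈ ball x (t * R) := by
      simp [dist_eq_norm, norm_smul, abs_of_pos ht, ht]
    by_cases hz : z ∈ ball x R
    · simp only [indicator_of_mem hz, indicator_of_mem (this.1 hz)]
    · simp only [indicator_of_notMem hz, indicator_of_notMem (mt this.2 hz)]
  simp_rw [e]
  rw [lintegral_sub_right_eq_self (fun w => (ball x (t * R)).indicator G (x + t • w)) x]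
  have hm : Measurable fun w => (ball x (t * R)).indicator G (x + w) :=
    (hG.indicator measurableSet_ball).comp (measurable_const_add x)
  have h := lintegral_map (μ := (volume : Measure Plane)) hm (measurable_const_smul t)
  rw [Measure.map_addHaar_smul volume ht.ne', lintegral_smul_measure,
    lintegral_add_left_eq_self (fun w => (ball x (t * R)).indicator G w) x] at h
  rw [← h]
  simp [abs_of_pos ht, smul_eq_mul]

/-- Integrating over `z` and exchanging integrals turns segments into the discs of radius `t * R`.
The Jacobian `t⁻²` of the homothety cancels the `t²` of the mean bound, so the integral in `t`
converges. -/
lemma setLIntegral_enorm_taylor_le [CompleteSpace F] {u : Plane → F} (hu : ContDiff ℝ 2 u)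
    (x : Plane) {R : ℝ} (hR : 0 < R) {Λ : ℝ≥0∞}
    (H : ∀ r, 0 < r → r ≤ R →
      ∫⁻ z in ball x r, ‖fderiv ℝ (fderiv ℝ u) z‖ₑ ≤ Λ * ENNReal.ofReal r ^ 2) :
    ∫⁻ z in ball x R, ‖u z - u x - fderiv ℝ u x (z - x)‖ₑ ≤ Λ * ENNReal.ofReal R ^ 4 := by
  have hu1 : ContDiff ℝ 1 (fderiv ℝ u) := hu.fderiv_right (by norm_num)
  have hu2 : Continuous (fderiv ℝ (fderiv ℝ u)) := hu1.continuous_fderiv one_ne_zero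
  calc ∫⁻ z in ball x R, ‖u z - u x - fderiv ℝ u x (z - x)‖ₑ
      ≤ ∫⁻ z in ball x R, ∫⁻ t in Ioc (0 : ℝ) 1,
          ‖fderiv ℝ (fderiv ℝ u) (x + t • (z - x))‖ₑ * ENNReal.ofReal R ^ 2 := by
        refine setLIntegral_mono' measurableSet_ball fun z hz => (enorm_taylor_le hu x z).trans ?_
        refine lintegral_mono fun t => ?_
        gcongr
        rw [← ofReal_norm, ← dist_eq_norm]
        exact ENNReal.ofReal_le_ofReal (mem_ball.1 hz).le
    _ = ∫⁻ t in Ioc (0 : ℝ) 1, ∫⁻ z in ball x R,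
          ‖fderiv ℝ (fderiv ℝ u) (x + t • (z - x))‖ₑ * ENNReal.ofReal R ^ 2 := by
        refine lintegral_lintegral_swap ?_
        have : Continuous fun p : Plane × ℝ => fderiv ℝ (fderiv ℝ u) (x + p.2 • (p.1 - x)) :=
          hu2.comp (by fun_prop)
        exact (this.enorm.measurable.mul_const _).aemeasurable
    _ ≤ ∫⁻ t in Ioc (0 : ℝ) 1, Λ * ENNReal.ofReal R ^ 4 := by
        refine setLIntegral_mono' measurableSet_Ioc fun t ht => ?_
        rw [lintegral_mul_const' _ _ (ENNReal.pow_ne_top ENNReal.ofReal_ne_top),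
          setLIntegral_ball_homothety (fun z => ‖fderiv ℝ (fderiv ℝ u) z‖ₑ) hu2.enorm.measurable
            x ht.1]
        have h1 := H (t * R) (mul_pos ht.1 hR) (mul_le_of_le_one_left hR.le ht.2)
        have h2 : ENNReal.ofReal (t ^ 2)⁻¹ * ENNReal.ofReal t ^ 2 = 1 := by
          rw [← ENNReal.ofReal_pow ht.1.le, ← ENNReal.ofReal_mul (by positivity),
            inv_mul_cancel₀ (pow_ne_zero 2 ht.1.ne'), ENNReal.ofReal_one]
        rw [ENNReal.ofReal_mul ht.1.le, mul_pow] at h1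
        calc _ ≤ ENNReal.ofReal (t ^ 2)⁻¹ * (Λ * (ENNReal.ofReal t ^ 2 * ENNReal.ofReal R ^ 2))
              * ENNReal.ofReal R ^ 2 := by gcongr
          _ = (ENNReal.ofReal (t ^ 2)⁻¹ * ENNReal.ofReal t ^ 2) * (Λ * ENNReal.ofReal R ^ 4) := by
              ring
          _ ≤ _ := by rw [h2, one_mul]
    _ = Λ * ENNReal.ofReal R ^ 4 := by simp

/-- A two point Taylor estimate: growth control of the mean of the second derivative around both
points suffices. -/
lemma enorm_taylor_le_of_mean_bound [CompleteSpace F] {u : Plane → F} (hu : ContDiff ℝ 2 u)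
    {x y : Plane} {R : ℝ} (hR : 0 < R) (hxy : dist y x ≤ R) {Λ : ℝ≥0∞}
    (Hx : ∀ r, 0 < r → r ≤ 2 * R →
      ∫⁻ z in ball x r, ‖fderiv ℝ (fderiv ℝ u) z‖ₑ ≤ Λ * ENNReal.ofReal r ^ 2)
    (Hy : ∀ r, 0 < r → r ≤ R →
      ∫⁻ z in ball y r, ‖fderiv ℝ (fderiv ℝ u) z‖ₑ ≤ Λ * ENNReal.ofReal r ^ 2) :
    ‖u y - u x - fderiv ℝ u x (y - x)‖ₑ ≤ 34 * Λ * ENNReal.ofReal R ^ 2 := by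
  have hx := setLIntegral_enorm_taylor_le hu x (by positivity) Hx
  have hy := setLIntegral_enorm_taylor_le hu y hR Hy
  -- The difference of the two first-order Taylor polynomials: affine in `z`, small in mean on the
  -- disc about `y`, and equal to the wanted remainder at `z = y`.
  set a : Plane → F := fun z =>
    (u y + fderiv ℝ u y (z - y)) - (u x + fderiv ℝ u x (z - x)) with ha
  have hac : Continuous a := by fun_prop
  have hball : ball y R ⊆ ball x (2 * R) := ball_subset_ball' (by linarith)
  have h1 : ∫⁻ z in ball y R, ‖a z‖ₑ ≤ 17 * Λ * ENNReal.ofReal R ^ 4 := by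
    have hm : Measurable fun z => ‖u z - u x - fderiv ℝ u x (z - x)‖ₑ :=
      Continuous.measurable (by have := hu.continuous; fun_prop)
    calc ∫⁻ z in ball y R, ‖a z‖ₑ
        ≤ ∫⁻ z in ball y R, (‖u z - u x - fderiv ℝ u x (z - x)‖ₑ +
            ‖u z - u y - fderiv ℝ u y (z - y)‖ₑ) := by
          refine lintegral_mono fun z => ?_
          have : a z = (u z - u x - fderiv ℝ u x (z - x)) - (u z - u y - fderiv ℝ u y (z - y)) := by
            simp only [ha]; abel
          simp only [this]
          exact enorm_sub_le
      _ = (∫⁻ z in ball y R, ‖u z - u x - fderiv ℝ u x (z - x)‖ₑ) +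
            ∫⁻ z in ball y R, ‖u z - u y - fderiv ℝ u y (z - y)‖ₑ := lintegral_add_left hm _
      _ ≤ Λ * ENNReal.ofReal (2 * R) ^ 4 + Λ * ENNReal.ofReal R ^ 4 :=
          add_le_add ((lintegral_mono_set hball).trans hx) hy
      _ = 17 * Λ * ENNReal.ofReal R ^ 4 := by
          rw [ENNReal.ofReal_mul zero_le_two, mul_pow, ENNReal.ofReal_ofNat]; ring
  -- An affine map takes at the centre the average of its values at symmetric points, so its mean
  -- over the disc controls its value at `y`.
  have hsym : ∀ w, ‖a y‖ₑ ≤ ‖a (y + w)‖ₑ + ‖a (y - w)‖ₑ := by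
    intro w
    have e : a (y + w) + a (y - w) = (2 : ℝ) • a y := by
      simp only [ha, two_smul, map_add, map_sub]; abel
    have h3 : ‖a y‖ ≤ ‖(2 : ℝ) • a y‖ := by
      rw [norm_smul]; norm_num; linarith [norm_nonneg (a y)]
    calc ‖a y‖ₑ ≤ ‖(2 : ℝ) • a y‖ₑ := enorm_le_iff_norm_le.2 h3
      _ ≤ _ := by rw [← e]; exact enorm_add_le _ _
  have hp : ∫⁻ w in ball (0 : Plane) R, ‖a (y + w)‖ₑ = ∫⁻ z in ball y R, ‖a z‖ₑ := by
    rw [← lintegral_indicator measurableSet_ball, ← lintegral_indicator measurableSet_ball,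
      ← lintegral_add_left_eq_self ((ball y R).indicator fun z => ‖a z‖ₑ) y]
    congr 1; ext w
    simp [indicator, dist_eq_norm]
  have hn : ∫⁻ w in ball (0 : Plane) R, ‖a (y - w)‖ₑ = ∫⁻ z in ball y R, ‖a z‖ₑ := by
    rw [← lintegral_indicator measurableSet_ball, ← lintegral_indicator measurableSet_ball,
      ← lintegral_sub_left_eq_self ((ball y R).indicator fun z => ‖a z‖ₑ) y]
    congr 1; ext w
    simp [indicator, dist_eq_norm]
  have h4 : ‖a y‖ₑ * ENNReal.ofReal R ^ 2 ≤ 34 * Λ * ENNReal.ofReal R ^ 2 * ENNReal.ofReal R ^ 2 := by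
    calc ‖a y‖ₑ * ENNReal.ofReal R ^ 2 ≤ ‖a y‖ₑ * volume (ball (0 : Plane) R) := by
          rw [EuclideanSpace.volume_ball_fin_two]
          gcongr
          refine le_mul_of_one_le_right' ?_
          rw [ENNReal.one_le_ofReal]
          linarith [Real.pi_gt_three]
      _ = ∫⁻ w in ball (0 : Plane) R, ‖a y‖ₑ := by simp
      _ ≤ ∫⁻ w in ball (0 : Plane) R, (‖a (y + w)‖ₑ + ‖a (y - w)‖ₑ) := lintegral_mono hsym
      _ = (∫⁻ z in ball y R, ‖a z‖ₑ) + ∫⁻ z in ball y R, ‖a z‖ₑ := by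
          have hm : Measurable fun w => ‖a (y + w)‖ₑ :=
            (hac.comp (continuous_const.add continuous_id)).enorm.measurable
          rw [lintegral_add_left hm, hp, hn]
      _ ≤ 17 * Λ * ENNReal.ofReal R ^ 4 + 17 * Λ * ENNReal.ofReal R ^ 4 := add_le_add h1 h1
      _ = _ := by ring
  have hay : a y = u y - u x - fderiv ℝ u x (y - x) := by simp [ha, sub_sub]
  rw [← hay]
  exact (ENNReal.mul_le_mul_iff_left (by simpa using hR)
    (ENNReal.pow_ne_top ENNReal.ofReal_ne_top)).1 h4

end Taylor

/-! ### Mollification and bounds on disc means -/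

section Mollifier

variable {F : Type*} [NormedAddCommGroup F] [NormedSpace ℝ F]

lemma enorm_normed_convolution_le (φ : ContDiffBump (0 : Plane)) (H : Plane → F) (z : Plane) :
    ‖(φ.normed volume ⋆[lsmul ℝ ℝ, volume] H) z‖ₑ ≤
      ∫⁻ s, ENNReal.ofReal (φ.normed volume (z - s)) * ‖H s‖ₑ := by
  rw [convolution_eq_swap]
  refine (enorm_integral_le_lintegral_enorm _).trans (lintegral_mono fun s => ?_)
  rw [lsmul_apply, enorm_smul, ← ofReal_norm, Real.norm_of_nonneg (φ.nonneg_normed _)]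

lemma lintegral_normed_sub_eq_one (φ : ContDiffBump (0 : Plane)) (s : Plane) :
    ∫⁻ z, ENNReal.ofReal (φ.normed volume (z - s)) = 1 := by
  rw [lintegral_sub_right_eq_self (fun z => ENNReal.ofReal (φ.normed volume z)) s,
    ← ofReal_integral_eq_lintegral_ofReal φ.integrable_normed
      (Eventually.of_forall φ.nonneg_normed), φ.integral_normed, ENNReal.ofReal_one]

lemma normed_sub_eq_zero (φ : ContDiffBump (0 : Plane)) {z s : Plane} (h : φ.rOut ≤ dist s z) :
    φ.normed volume (z - s) = 0 := by
  have : z - s ∉ Function.support (φ.normed (volume : Measure Plane)) := by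
    rw [φ.support_normed_eq, mem_ball_zero_iff, ← dist_eq_norm, dist_comm]
    exact h.not_gt
  simpa using this

lemma setLIntegral_normed_convolution_le (φ : ContDiffBump (0 : Plane)) {H : Plane → F}
    (hH : AEStronglyMeasurable H volume) (x : Plane) (r : ℝ) :
    ∫⁻ z in ball x r, ‖(φ.normed volume ⋆[lsmul ℝ ℝ, volume] H) z‖ₑ ≤
      ∫⁻ s in ball x (r + φ.rOut), ‖H s‖ₑ := by
  calc ∫⁻ z in ball x r, ‖(φ.normed volume ⋆[lsmul ℝ ℝ, volume] H) z‖ₑ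
      ≤ ∫⁻ z in ball x r, ∫⁻ s, ENNReal.ofReal (φ.normed volume (z - s)) *
          (ball x (r + φ.rOut)).indicator (fun s => ‖H s‖ₑ) s := by
        refine setLIntegral_mono' measurableSet_ball fun z hz =>
          (enorm_normed_convolution_le φ H z).trans (lintegral_mono fun s => ?_)
        by_cases hs : s ∈ ball x (r + φ.rOut)
        · simp [hs]
        · rw [normed_sub_eq_zero φ]
          · simp
          · by_contra! h
            exact hs (mem_ball.2 (by linarith [dist_triangle s z x, mem_ball.1 hz]))
    _ ≤ ∫⁻ z, ∫⁻ s, ENNReal.ofReal (φ.normed volume (z - s)) *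
          (ball x (r + φ.rOut)).indicator (fun s => ‖H s‖ₑ) s := setLIntegral_le_lintegral _ _
    _ = ∫⁻ s, ∫⁻ z, ENNReal.ofReal (φ.normed volume (z - s)) *
          (ball x (r + φ.rOut)).indicator (fun s => ‖H s‖ₑ) s := by
        refine lintegral_lintegral_swap (AEMeasurable.mul ?_ ?_)
        · exact (ENNReal.continuous_ofReal.comp
            (φ.continuous_normed.comp (continuous_fst.sub continuous_snd))).measurable.aemeasurable
        · exact (hH.enorm.indicator measurableSet_ball).comp_snd
    _ = ∫⁻ s, (ball x (r + φ.rOut)).indicator (fun s => ‖H s‖ₑ) s := by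
        refine lintegral_congr fun s => ?_
        rw [lintegral_mul_const, lintegral_normed_sub_eq_one, one_mul]
        exact (ENNReal.continuous_ofReal.comp
            (φ.continuous_normed.comp (continuous_id.sub continuous_const))).measurable
    _ = _ := lintegral_indicator measurableSet_ball _

/-- Uniformity in the scale `ε` comes from two regimes. For `ε ≤ r` the mass comes from the disc of
radius `r + ε`. For `r < ε` the kernel is at most `4 / (π ε²)` and only the disc of radius `2 ε`
about `x` contributes. -/
lemma setLIntegral_normed_convolution_le_of_mean_bound (φ : ContDiffBump (0 : Plane))
    (hφ : φ.rOut ≤ 2 * φ.rIn) {H : Plane → F} (hH : AEStronglyMeasurable H volume)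
    {x : Plane} {Λ : ℝ≥0∞}
    (hΛ : ∀ r, 0 < r → ∫⁻ z in ball x r, ‖H z‖ₑ ≤ Λ * ENNReal.ofReal r ^ 2) {r : ℝ} (hr : 0 < r) :
    ∫⁻ z in ball x r, ‖(φ.normed volume ⋆[lsmul ℝ ℝ, volume] H) z‖ₑ ≤
      16 * Λ * ENNReal.ofReal r ^ 2 := by
  have hε := φ.rOut_pos
  set ε := φ.rOut with hεdef
  rcases le_or_gt ε r with h | h
  · refine (setLIntegral_normed_convolution_le φ hH x r).trans
      ((hΛ _ (by positivity)).trans ?_)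
    -- Here `2 * r` would suffice; `4 * r` matches the constant `16` of the other regime.
    calc Λ * ENNReal.ofReal (r + φ.rOut) ^ 2 ≤ Λ * ENNReal.ofReal (4 * r) ^ 2 := by
          gcongr; linarith
      _ = _ := by rw [ENNReal.ofReal_mul (by norm_num), ENNReal.ofReal_ofNat]; ring
  · have hmax : ∀ y, φ.normed volume y ≤ 4 / (Real.pi * ε ^ 2) := by
      intro y
      refine (φ.normed_le_div_measure_closedBall_rOut volume 2 hφ y).trans (le_of_eq ?_)
      rw [Measure.real, EuclideanSpace.volume_closedBall_fin_two, finrank_euclideanSpace_fin,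
        ENNReal.toReal_mul, ENNReal.toReal_pow, ENNReal.toReal_ofReal hε.le,
        ENNReal.toReal_ofReal Real.pi_pos.le]
      ring
    have hpt : ∀ z ∈ ball x r, ‖(φ.normed volume ⋆[lsmul ℝ ℝ, volume] H) z‖ₑ ≤
        ENNReal.ofReal (4 / (Real.pi * ε ^ 2)) * (Λ * ENNReal.ofReal (2 * ε) ^ 2) := by
      intro z hz
      refine (enorm_normed_convolution_le φ H z).trans ?_
      calc ∫⁻ s, ENNReal.ofReal (φ.normed volume (z - s)) * ‖H s‖ₑ
          ≤ ∫⁻ s, ENNReal.ofReal (4 / (Real.pi * ε ^ 2)) *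
              (ball x (2 * ε)).indicator (fun s => ‖H s‖ₑ) s := by
            refine lintegral_mono fun s => ?_
            by_cases hs : s ∈ ball x (2 * ε)
            · simp only [indicator_of_mem hs]
              gcongr
              exact hmax _
            · rw [normed_sub_eq_zero φ]
              · simp
              · by_contra! h'
                exact hs (mem_ball.2 (by linarith [dist_triangle s z x, mem_ball.1 hz]))
        _ = ENNReal.ofReal (4 / (Real.pi * ε ^ 2)) * ∫⁻ s in ball x (2 * ε), ‖H s‖ₑ := by
            rw [lintegral_const_mul' _ _ ENNReal.ofReal_ne_top, lintegral_indicator measurableSet_ball]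
        _ ≤ _ := by gcongr; exact hΛ _ (by positivity)
    refine (setLIntegral_mono' measurableSet_ball hpt).trans (le_of_eq ?_)
    rw [setLIntegral_const, EuclideanSpace.volume_ball_fin_two]
    have hone : ENNReal.ofReal (4 / (Real.pi * ε ^ 2)) * ENNReal.ofReal (2 * ε) ^ 2 *
        ENNReal.ofReal Real.pi = 16 := by
      rw [← ENNReal.ofReal_pow (by positivity), ← ENNReal.ofReal_mul (by positivity),
        ← ENNReal.ofReal_mul (by positivity), ← ENNReal.ofReal_ofNat]
      congr 1
      field_simp
      norm_num
    calc _ = (ENNReal.ofReal (4 / (Real.pi * ε ^ 2)) * ENNReal.ofReal (2 * ε) ^ 2 *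
        ENNReal.ofReal Real.pi) * Λ * ENNReal.ofReal r ^ 2 := by ring
      _ = _ := by rw [hone]

end Mollifier

/-! ### Differentiation of measures -/

/-- Small radii are governed by the density, finite almost everywhere, and large radii by the total
mass. An integer bound allows exhaustion by countably many sets. -/
lemma ae_exists_measure_ball_le (lam : Measure Plane) [IsFiniteMeasure lam] :
    ∀ᵐ x : Plane, ∃ m : ℕ, ∀ r, 0 < r → lam (ball x r) ≤ m * ENNReal.ofReal r ^ 2 := by
  filter_upwards [Besicovitch.ae_tendsto_rnDeriv lam volume, lam.rnDeriv_lt_top volume]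
    with x hx hfin
  have h1 := hx.eventually_lt_const (ENNReal.lt_add_right hfin.ne one_ne_zero)
  obtain ⟨r₀, hr₀, hlt⟩ := mem_nhdsGT_iff_exists_Ioo_subset.1 h1
  have hr₀ : 0 < r₀ := hr₀
  set M := lam.rnDeriv volume x + 1 with hM
  have hMtop : M ≠ ⊤ := by finiteness
  set B := M * ENNReal.ofReal Real.pi + lam univ / ENNReal.ofReal r₀ ^ 2 with hB
  have hBtop : B ≠ ⊤ := by
    refine ENNReal.add_ne_top.2 ⟨ENNReal.mul_ne_top hMtop ENNReal.ofReal_ne_top, ?_⟩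
    exact ENNReal.div_ne_top (measure_ne_top _ _) (by simpa using hr₀)
  obtain ⟨m, hm⟩ := ENNReal.exists_nat_gt hBtop
  refine ⟨m, fun r hr => le_trans ?_ (mul_le_mul_left hm.le _)⟩
  rcases lt_or_ge r r₀ with h | h
  · have h2 : lam (closedBall x r) / volume (closedBall x r) < M := hlt ⟨hr, h⟩
    have h3 := (ENNReal.div_lt_iff (.inl (measure_closedBall_pos volume x hr).ne')
      (.inl measure_closedBall_lt_top.ne)).1 h2
    rw [EuclideanSpace.volume_closedBall_fin_two] at h3
    calc lam (ball x r) ≤ lam (closedBall x r) := measure_mono ball_subset_closedBall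
      _ ≤ M * (ENNReal.ofReal r ^ 2 * ENNReal.ofReal Real.pi) := h3.le
      _ = M * ENNReal.ofReal Real.pi * ENNReal.ofReal r ^ 2 := by ring
      _ ≤ B * ENNReal.ofReal r ^ 2 := by gcongr; exact le_self_add
  · calc lam (ball x r) ≤ lam univ := measure_mono (subset_univ _)
      _ = lam univ / ENNReal.ofReal r₀ ^ 2 * ENNReal.ofReal r₀ ^ 2 :=
          (ENNReal.div_mul_cancel (by simpa using hr₀)
            (ENNReal.pow_ne_top ENNReal.ofReal_ne_top)).symm
      _ ≤ B * ENNReal.ofReal r ^ 2 := by gcongr; exact le_add_self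

/-! ### Convergence of mollifications in the mean -/

section Approximation

variable {F : Type*} [NormedAddCommGroup F] [NormedSpace ℝ F]

lemma lintegral_normed_convolution_le (φ : ContDiffBump (0 : Plane)) {H : Plane → F}
    (hH : AEStronglyMeasurable H volume) :
    ∫⁻ z, ‖(φ.normed volume ⋆[lsmul ℝ ℝ, volume] H) z‖ₑ ≤ ∫⁻ s, ‖H s‖ₑ := by
  calc ∫⁻ z, ‖(φ.normed volume ⋆[lsmul ℝ ℝ, volume] H) z‖ₑ
      ≤ ∫⁻ z, ∫⁻ s, ENNReal.ofReal (φ.normed volume (z - s)) * ‖H s‖ₑ :=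
        lintegral_mono (enorm_normed_convolution_le φ H)
    _ = ∫⁻ s, ∫⁻ z, ENNReal.ofReal (φ.normed volume (z - s)) * ‖H s‖ₑ := by
        refine lintegral_lintegral_swap (AEMeasurable.mul ?_ hH.enorm.comp_snd)
        exact (ENNReal.continuous_ofReal.comp
          (φ.continuous_normed.comp (continuous_fst.sub continuous_snd))).measurable.aemeasurable
    _ = ∫⁻ s, ‖H s‖ₑ := by
        refine lintegral_congr fun s => ?_
        rw [lintegral_mul_const, lintegral_normed_sub_eq_one, one_mul]
        exact (ENNReal.continuous_ofReal.comp
            (φ.continuous_normed.comp (continuous_id.sub continuous_const))).measurable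

lemma tendsto_setLIntegral_normed_convolution_sub [CompleteSpace F] {φ : ℕ → ContDiffBump (0 : Plane)}
    (hφ : Tendsto (fun n => (φ n).rOut) atTop (𝓝 0)) {H : Plane → F} (hH : Integrable H)
    {U : Set Plane} (hU : volume U ≠ ⊤) :
    Tendsto (fun n => ∫⁻ z in U, ‖H z - ((φ n).normed volume ⋆[lsmul ℝ ℝ, volume] H) z‖ₑ)
      atTop (𝓝 0) := by
  rw [ENNReal.tendsto_atTop_zero]
  intro ε hε
  rcases eq_or_ne ε ⊤ with rfl | hεtop
  · exact ⟨0, fun _ _ => le_top⟩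
  have hε3 : ε / 3 ≠ 0 := (ENNReal.div_pos hε.ne' (by norm_num)).ne'
  -- Approximation by a continuous compactly supported `w`: its mollification error is uniformly at
  -- most `δ`, which costs `δ * volume U`, and convolution does not increase the norm of `H - w`.
  obtain ⟨w, hwc, hw, hwcont, hwint⟩ := hH.exists_hasCompactSupport_lintegral_sub_le hε3
  obtain ⟨δ, hδ, hδU⟩ : ∃ δ : ℝ, 0 < δ ∧ ENNReal.ofReal δ * volume U ≤ ε / 3 := by
    obtain ⟨δ, hδ, h⟩ := ENNReal.exists_pos_mul_lt hU hε3
    refine ⟨(min δ 1).toReal, ENNReal.toReal_pos (by simp [hδ.ne']) (by simp), ?_⟩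
    rw [ENNReal.ofReal_toReal (by simp)]
    exact (mul_le_mul_left (min_le_left _ _) _).trans (h.le)
  have huc := hwc.uniformContinuous_of_continuous hwcont
  obtain ⟨η, hη, hηw⟩ := Metric.uniformContinuous_iff.1 huc δ hδ
  obtain ⟨N, hN⟩ := eventually_atTop.1 (hφ.eventually_lt_const hη)
  refine ⟨N, fun n hn => ?_⟩
  have hHw : Integrable (fun z => H z - w z) := hH.sub hwint
  have hpt : ∀ z, ‖H z - ((φ n).normed volume ⋆[lsmul ℝ ℝ, volume] H) z‖ₑ ≤
      ‖H z - w z‖ₑ + (ENNReal.ofReal δ +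
        ‖((φ n).normed volume ⋆[lsmul ℝ ℝ, volume] fun z => H z - w z) z‖ₑ) := by
    intro z
    have hcs := (φ n).hasCompactSupport_normed (μ := (volume : Measure Plane))
    have ex : ∀ {G : Plane → F}, Integrable G →
        ConvolutionExistsAt ((φ n).normed volume) G z (lsmul ℝ ℝ) volume := fun hG =>
      hcs.convolutionExists_left (lsmul ℝ ℝ) (φ n).continuous_normed hG.locallyIntegrable z
    have hsplit : ((φ n).normed volume ⋆[lsmul ℝ ℝ, volume] H) z =
        ((φ n).normed volume ⋆[lsmul ℝ ℝ, volume] w) z +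
        ((φ n).normed volume ⋆[lsmul ℝ ℝ, volume] fun z => H z - w z) z := by
      rw [← ConvolutionExistsAt.distrib_add (ex hwint) (ex hHw)]
      congr 1; ext z; simp
    have hclose : dist (((φ n).normed volume ⋆[lsmul ℝ ℝ, volume] w) z) (w z) ≤ δ :=
      (φ n).dist_normed_convolution_le hwint.aestronglyMeasurable
        fun y hy => (hηw ((mem_ball.1 hy).trans (hN n hn))).le
    have hclose' : ‖w z - ((φ n).normed volume ⋆[lsmul ℝ ℝ, volume] w) z‖ₑ ≤ ENNReal.ofReal δ := by
      rw [← ofReal_norm, ← dist_eq_norm, dist_comm]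
      exact ENNReal.ofReal_le_ofReal hclose
    have e : H z - ((φ n).normed volume ⋆[lsmul ℝ ℝ, volume] H) z = (H z - w z) +
        ((w z - ((φ n).normed volume ⋆[lsmul ℝ ℝ, volume] w) z) -
        ((φ n).normed volume ⋆[lsmul ℝ ℝ, volume] fun z => H z - w z) z) := by
      rw [hsplit]; abel
    rw [e]
    exact (enorm_add_le _ _).trans (add_le_add le_rfl (enorm_sub_le.trans (add_le_add hclose' le_rfl)))
  calc ∫⁻ z in U, ‖H z - ((φ n).normed volume ⋆[lsmul ℝ ℝ, volume] H) z‖ₑ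
      ≤ ∫⁻ z in U, (‖H z - w z‖ₑ + (ENNReal.ofReal δ +
        ‖((φ n).normed volume ⋆[lsmul ℝ ℝ, volume] fun z => H z - w z) z‖ₑ)) := lintegral_mono hpt
    _ = (∫⁻ z in U, ‖H z - w z‖ₑ) + (ENNReal.ofReal δ * volume U + ∫⁻ z in U,
        ‖((φ n).normed volume ⋆[lsmul ℝ ℝ, volume] fun z => H z - w z) z‖ₑ) := by
        rw [lintegral_add_left' hHw.aestronglyMeasurable.enorm.restrict,
          lintegral_add_left measurable_const, setLIntegral_const]
    _ ≤ ε / 3 + (ε / 3 + ε / 3) := by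
        refine add_le_add ((setLIntegral_le_lintegral _ _).trans hw) (add_le_add hδU ?_)
        exact (setLIntegral_le_lintegral _ _).trans
          ((lintegral_normed_convolution_le (φ n) hHw.aestronglyMeasurable).trans hw)
    _ = ε := by rw [← add_assoc, ENNReal.add_thirds]

end Approximation

/-! ### Quantitative invertibility -/

lemma ContinuousLinearMap.exists_norm_le_mul_norm_apply {A : Plane →L[ℝ] Plane} (hA : A.det ≠ 0) :
    ∃ C : ℝ, 0 < C ∧ ∀ v, ‖v‖ ≤ C * ‖A v‖ := by
  set e := A.toContinuousLinearEquivOfDetNeZero hA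
  refine ⟨‖(e.symm : Plane →L[ℝ] Plane)‖ + 1, by positivity, fun v => ?_⟩
  have h := (e.symm : Plane →L[ℝ] Plane).le_opNorm (A v)
  have h2 : (e.symm : Plane →L[ℝ] Plane) (A v) = v := e.symm_apply_apply v
  rw [h2] at h
  nlinarith [norm_nonneg (A v)]

lemma ContinuousLinearMap.det_ne_zero_of_norm_le {A : Plane →L[ℝ] Plane} {C : ℝ}
    (h : ∀ v, ‖v‖ ≤ C * ‖A v‖) : A.det ≠ 0 := by
  intro hA
  have hker := LinearMap.bot_lt_ker_of_det_eq_zero hA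
  obtain ⟨v, hv, hv0⟩ := (Submodule.ne_bot_iff _).1 hker.ne'
  have hv' : A v = 0 := hv
  have := h v
  rw [hv', norm_zero, mul_zero] at this
  exact hv0 (norm_le_zero_iff.1 this)

lemma eventually_norm_le_mul_norm_apply {A : ℕ → Plane →L[ℝ] Plane} {B : Plane →L[ℝ] Plane}
    (hAB : Tendsto A atTop (𝓝 B)) (hB : B.det ≠ 0) :
    ∃ m : ℕ, ∀ n, m ≤ n → ∀ v, ‖v‖ ≤ m * ‖A n v‖ := by
  obtain ⟨C, hC, hle⟩ := B.exists_norm_le_mul_norm_apply hB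
  obtain ⟨N, hN⟩ := (Metric.tendsto_atTop.1 hAB) (1 / (2 * C)) (by positivity)
  obtain ⟨M, hM⟩ := exists_nat_ge (2 * C)
  refine ⟨max N M, fun n hn v => ?_⟩
  have h1 := hN n ((le_max_left _ _).trans hn)
  rw [dist_eq_norm] at h1
  have h2 : ‖B v‖ ≤ ‖A n v‖ + 1 / (2 * C) * ‖v‖ := by
    calc ‖B v‖ = ‖A n v - (A n - B) v‖ := by simp
      _ ≤ ‖A n v‖ + ‖(A n - B) v‖ := norm_sub_le _ _
      _ ≤ _ := by gcongr; exact le_of_opNorm_le _ h1.le v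
  have h3 : ‖v‖ ≤ C * ‖A n v‖ + ‖v‖ / 2 := by
    calc ‖v‖ ≤ C * ‖B v‖ := hle v
      _ ≤ C * (‖A n v‖ + 1 / (2 * C) * ‖v‖) := by gcongr
      _ = _ := by field_simp
  have h4 : (2 * C) * ‖A n v‖ ≤ (max N M : ℕ) * ‖A n v‖ := by
    gcongr
    exact hM.trans (by exact_mod_cast le_max_right _ _)
  linarith

/-! ### Mollification at a sequence of scales -/

/-- Bump functions with outer radius `1 / (n + 1)`. -/
noncomputable def shrinkingBump (n : ℕ) : ContDiffBump (0 : Plane) where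
  rIn := 1 / (2 * (n + 1))
  rOut := 1 / (n + 1)
  rIn_pos := by positivity
  rIn_lt_rOut := by
    have : (0 : ℝ) < n + 1 := by positivity
    exact one_div_lt_one_div_of_lt this (by linarith)

lemma shrinkingBump_rOut_le (n : ℕ) : (shrinkingBump n).rOut ≤ 2 * (shrinkingBump n).rIn := by
  simp only [shrinkingBump]
  apply le_of_eq
  field_simp

lemma tendsto_shrinkingBump_rOut : Tendsto (fun n => (shrinkingBump n).rOut) atTop (𝓝 0) :=
  tendsto_one_div_add_atTop_nhds_zero_nat

/-- The mollification of `H` at scale `1 / (n + 1)`. -/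
noncomputable def mollify {F : Type*} [NormedAddCommGroup F] [NormedSpace ℝ F] (n : ℕ)
    (H : Plane → F) : Plane → F :=
  (shrinkingBump n).normed volume ⋆[lsmul ℝ ℝ, volume] H

section Mollify

variable {F : Type*} [NormedAddCommGroup F] [NormedSpace ℝ F]

lemma contDiff_mollify [CompleteSpace F] (n : ℕ) {H : Plane → F} (hH : LocallyIntegrable H) :
    ContDiff ℝ ∞ (mollify n H) :=
  (shrinkingBump n).hasCompactSupport_normed.contDiff_convolution_left _
    (shrinkingBump n).contDiff_normed hH

lemma fderiv_mollify [CompleteSpace F] {u : Plane → F} {D : Plane → Plane →L[ℝ] F}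
    {U : Set Plane} (hU : IsOpen U) (h : HasWeakFDerivOn u D U) (hu : IntegrableOn u U)
    (hD : IntegrableOn D U) {n : ℕ} {x : Plane}
    (hx : closedBall x (shrinkingBump n).rOut ⊆ U) :
    fderiv ℝ (mollify n (U.indicator u)) x = mollify n (U.indicator D) x := by
  refine h.fderiv_convolution hU hu hD (shrinkingBump n).contDiff_normed
    (shrinkingBump n).hasCompactSupport_normed fun y hy => hx ?_
  rw [(shrinkingBump n).tsupport_normed_eq] at hy
  simpa [dist_eq_norm] using hy

lemma fderiv_fderiv_mollify [CompleteSpace F] {u : Plane → F} {D : Plane → Plane →L[ℝ] F}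
    {D2 : Plane → Plane →L[ℝ] Plane →L[ℝ] F} {U : Set Plane} (hU : IsOpen U)
    (h : HasWeakFDerivOn u D U) (h2 : HasWeakFDerivOn D D2 U) (hu : IntegrableOn u U)
    (hD : IntegrableOn D U) (hD2 : IntegrableOn D2 U) {n : ℕ} {W : Set Plane} (hW : IsOpen W)
    (hWU : ∀ x ∈ W, closedBall x (shrinkingBump n).rOut ⊆ U) {x : Plane} (hx : x ∈ W) :
    fderiv ℝ (fderiv ℝ (mollify n (U.indicator u))) x = mollify n (U.indicator D2) x := by
  rw [← fderiv_mollify hU h2 hD hD2 (hWU x hx)]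
  refine Filter.EventuallyEq.fderiv_eq ?_
  filter_upwards [hW.mem_nhds hx] with z hz using fderiv_mollify hU h hu hD (hWU z hz)

lemma ae_tendsto_mollify [CompleteSpace F] {H : Plane → F} (hH : LocallyIntegrable H) :
    ∀ᵐ x, Tendsto (fun n => mollify n H x) atTop (𝓝 (H x)) :=
  ContDiffBump.ae_convolution_tendsto_right_of_locallyIntegrable tendsto_shrinkingBump_rOut
    (Eventually.of_forall shrinkingBump_rOut_le) hH

/-- Provides one neighbourhood `W` of `K`, independent of `n`, where mollification eventually
commutes with differentiation. -/
lemma eventually_closedBall_rOut_subset {K U : Set Plane} (hK : IsCompact K) (hU : IsOpen U)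
    (hKU : K ⊆ U) : ∃ W : Set Plane, IsOpen W ∧ W ⊆ U ∧ (∃ d : ℝ, 0 < d ∧ ∀ x ∈ K, ball x d ⊆ W) ∧
      ∀ᶠ n in atTop, ∀ x ∈ W, closedBall x (shrinkingBump n).rOut ⊆ U := by
  obtain ⟨d, hd, hdU⟩ := hK.exists_thickening_subset_open hU hKU
  refine ⟨thickening (d / 2) K, isOpen_thickening,
    (thickening_mono (by linarith) K).trans hdU, ⟨d / 2, by positivity, fun x hx =>
      ball_subset_thickening hx _⟩, ?_⟩
  filter_upwards [tendsto_shrinkingBump_rOut.eventually_lt_const (half_pos hd)] with n hn x hx y hy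
  obtain ⟨z, hz, hxz⟩ := mem_thickening_iff.1 hx
  refine hdU (mem_thickening_iff.2 ⟨z, hz, ?_⟩)
  linarith [dist_triangle y x z, mem_closedBall.1 hy]

lemma mollify_uniform_close [CompleteSpace F] {u : Plane → F} {U K : Set Plane} (hU : IsOpen U)
    (hK : IsCompact K) (hKU : K ⊆ U) (hu : IntegrableOn u U) (hc : ContinuousOn u U)
    {ε : ℝ} (hε : 0 < ε) :
    ∀ᶠ n in atTop, ∀ x ∈ K, dist (mollify n (U.indicator u) x) (u x) ≤ ε := by
  have hca : ∀ a ∈ K, ContinuousAt (U.indicator u) a := fun a ha =>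
    (hc.continuousAt (hU.mem_nhds (hKU ha))).congr
      (Filter.eventuallyEq_of_mem (hU.mem_nhds (hKU ha)) fun z hz => (indicator_of_mem hz u).symm)
  obtain ⟨δ, hδ, h⟩ := Metric.mem_uniformity_dist.1
    (hK.uniformContinuousAt_of_continuousAt (U.indicator u) hca (Metric.dist_mem_uniformity hε))
  filter_upwards [tendsto_shrinkingBump_rOut.eventually_lt_const hδ] with n hn x hx
  have := (shrinkingBump n).dist_normed_convolution_le (μ := volume) (g := U.indicator u)
    (x₀ := x) (ε := ε) (hu.integrable_indicator hU.measurableSet).aestronglyMeasurable ?_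
  · rwa [indicator_of_mem (hKU hx)] at this
  · intro y hy
    have h2 := h (a := x) (b := y) (by rw [dist_comm]; exact (mem_ball.1 hy).trans hn)
    rw [dist_comm]
    exact (h2 hx).le

end Mollify

/-! ### Good points and injectivity of the mollifications -/

/-- The points of `K` where the mollified gradients are invertible with a uniform bound and the
means of `D2` over discs are controlled. -/
def regularSet (u : Plane → Plane) (D2 : Plane → Plane →L[ℝ] Plane →L[ℝ] Plane)
    (K : Set Plane) (m : ℕ) : Set Plane :=
  {x ∈ K | (∀ n, m ≤ n → ∀ v, ‖v‖ ≤ m * ‖fderiv ℝ (mollify n u) x v‖) ∧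
    ∀ r, 0 < r → ∫⁻ z in ball x r, ‖D2 z‖ₑ ≤ m * ENNReal.ofReal r ^ 2}

lemma regularSet_mono (u : Plane → Plane) (D2 : Plane → Plane →L[ℝ] Plane →L[ℝ] Plane)
    (K : Set Plane) : Monotone (regularSet u D2 K) := by
  intro m m' hm x ⟨hK, h1, h2⟩
  refine ⟨hK, fun n hn v => (h1 n (hm.trans hn) v).trans ?_, fun r hr => (h2 r hr).trans ?_⟩
  · gcongr
  · gcongr

section Regular

variable {Ω : Set Plane} {f : Plane → Plane} {D : Plane → Plane →L[ℝ] Plane}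
  {D2 : Plane → Plane →L[ℝ] Plane →L[ℝ] Plane}

lemma exists_lt_measure_regularSet (hΩ : IsOpen Ω) (hf : HasWeakFDerivOn f D Ω)
    (hfi : IntegrableOn f Ω) (hDi : IntegrableOn D Ω) (hD2i : IntegrableOn D2 Ω)
    (hJ : ∀ᵐ x ∂volume.restrict Ω, (D x).det ≠ 0) {K : Set Plane} (hK : K ⊆ Ω)
    {a : ℝ≥0∞} (ha : a < volume K) :
    ∃ m, a < volume (regularSet (Ω.indicator f) (Ω.indicator D2) K m) := by
  have hD2i' : Integrable (Ω.indicator D2) := hD2i.integrable_indicator hΩ.measurableSet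
  have hDi' : Integrable (Ω.indicator D) := hDi.integrable_indicator hΩ.measurableSet
  have : IsFiniteMeasure (volume.withDensity fun z => ‖Ω.indicator D2 z‖ₑ) :=
    isFiniteMeasure_withDensity hD2i'.hasFiniteIntegral.ne
  have hsub : volume K ≤ volume (⋃ m, regularSet (Ω.indicator f) (Ω.indicator D2) K m) := by
    refine measure_mono_ae ?_
    filter_upwards [ae_exists_measure_ball_le (volume.withDensity fun z => ‖Ω.indicator D2 z‖ₑ),
      ae_tendsto_mollify hDi'.locallyIntegrable, (ae_restrict_iff' hΩ.measurableSet).1 hJ]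
      with x hx1 hx2 hx3 hxK
    have hxΩ := hK hxK
    obtain ⟨m₁, hm₁⟩ := hx1
    rw [indicator_of_mem hxΩ] at hx2
    obtain ⟨W, hWo, -, ⟨d, hd, hdW⟩, hW⟩ := eventually_closedBall_rOut_subset
      (isCompact_singleton (x := x)) hΩ (singleton_subset_iff.2 hxΩ)
    have hxW : x ∈ W := hdW x rfl (mem_ball_self hd)
    have hlim : Tendsto (fun n => fderiv ℝ (mollify n (Ω.indicator f)) x) atTop (𝓝 (D x)) := by
      refine hx2.congr' ?_
      filter_upwards [hW] with n hn using (fderiv_mollify hΩ hf hfi hDi (hn x hxW)).symm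
    obtain ⟨m₂, hm₂⟩ := eventually_norm_le_mul_norm_apply hlim (hx3 hxΩ)
    refine mem_iUnion.2 ⟨max m₁ m₂, hxK, fun n hn v => ?_, fun r hr => ?_⟩
    · refine (hm₂ n ((le_max_right _ _).trans hn) v).trans ?_
      gcongr
      exact le_max_right _ _
    · have := hm₁ r hr
      rw [withDensity_apply _ measurableSet_ball] at this
      refine this.trans ?_
      gcongr
      exact le_max_left _ _
  -- Continuity from below along a monotone sequence; no measurability of the good sets is required.
  rw [(regularSet_mono _ _ K).measure_iUnion] at hsub
  exact lt_iSup_iff.1 (ha.trans_le hsub)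

lemma eventually_separated_on_regularSet (hΩ : IsOpen Ω) (hf : HasWeakFDerivOn f D Ω)
    (hD : HasWeakFDerivOn D D2 Ω)
    (hfi : IntegrableOn f Ω) (hDi : IntegrableOn D Ω) (hD2i : IntegrableOn D2 Ω)
    (hfc : ContinuousOn f Ω) (hinj : InjOn f Ω) {K : Set Plane} (hKc : IsCompact K) (hK : K ⊆ Ω)
    (m : ℕ) :
    ∃ η : ℝ, 0 < η ∧ ∀ᶠ n in atTop, ∀ x ∈ regularSet (Ω.indicator f) (Ω.indicator D2) K m,
      ∀ y ∈ regularSet (Ω.indicator f) (Ω.indicator D2) K m,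
      ‖y - x‖ ≤ 2 * m * ‖mollify n (Ω.indicator f) y - mollify n (Ω.indicator f) x‖ ∨
        η ≤ ‖mollify n (Ω.indicator f) y - mollify n (Ω.indicator f) x‖ := by
  obtain ⟨W, hWo, hWΩ, ⟨d, hd, hdW⟩, hW⟩ := eventually_closedBall_rOut_subset hKc hΩ hK
  set M : ℝ := 34 * (16 * m) with hM
  -- The first bound keeps discs of radius `2 * dist y x` about points of `K` inside `W`; the second
  -- gives `m * M * ‖y - x‖ ≤ 1 / 2`, so the quadratic remainder is absorbed. Neither depends on
  -- `n`.
  set s₀ : ℝ := min (d / 2) (1 / (2 * (m * M + 1))) with hs₀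
  have hMpos : 0 ≤ m * M := by positivity
  have hs₀pos : 0 < s₀ := lt_min (by positivity) (by positivity)
  -- Mollification moves each of the two images by at most `η`, so a gap of `3 * η` leaves `η`.
  obtain ⟨η, hη, hsep⟩ : ∃ η : ℝ, 0 < η ∧ ∀ x ∈ K, ∀ y ∈ K, s₀ ≤ dist y x → 3 * η ≤ dist (f y) (f x) := by
    set T := (K ×ˢ K) ∩ {p : Plane × Plane | s₀ ≤ dist p.2 p.1} with hT
    have hTc : IsCompact T := (hKc.prod hKc).inter_right
      (isClosed_le continuous_const (continuous_snd.dist continuous_fst))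
    have hcont : ContinuousOn (fun p : Plane × Plane => dist (f p.2) (f p.1)) T := by
      refine continuous_dist.comp_continuousOn (ContinuousOn.prodMk ?_ ?_)
      · exact hfc.comp continuousOn_snd fun p hp => hK hp.1.2
      · exact hfc.comp continuousOn_fst fun p hp => hK hp.1.1
    rcases T.eq_empty_or_nonempty with hTe | hTn
    · refine ⟨1, one_pos, fun x hx y hy h => ?_⟩
      have : (x, y) ∈ T := ⟨⟨hx, hy⟩, h⟩
      simp [hTe] at this
    · obtain ⟨p, hp, hmin⟩ := hTc.exists_isMinOn hTn hcont
      have hpos : 0 < dist (f p.2) (f p.1) := by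
        refine dist_pos.2 fun he => ?_
        have := hinj (hK hp.1.2) (hK hp.1.1) he
        have h2 : s₀ ≤ dist p.2 p.1 := hp.2
        rw [this, dist_self] at h2
        linarith
      refine ⟨dist (f p.2) (f p.1) / 3, by positivity, fun x hx y hy h => ?_⟩
      have h3 : dist (f p.2) (f p.1) ≤ dist (f y) (f x) := hmin (a := (x, y)) ⟨⟨hx, hy⟩, h⟩
      linarith
  refine ⟨η, hη, ?_⟩
  filter_upwards [hW, mollify_uniform_close hΩ hKc hK hfi hfc hη, eventually_ge_atTop m]
    with n hn hclose hmn x hx y hy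
  set g := mollify n (Ω.indicator f) with hg
  rcases eq_or_ne y x with rfl | hne
  · left; simp
  have hgs : ContDiff ℝ ∞ g :=
    contDiff_mollify n (hfi.integrable_indicator hΩ.measurableSet).locallyIntegrable
  rcases lt_or_ge (dist y x) s₀ with hlt | hge
  · left
    have hR : 0 < dist y x := dist_pos.2 hne
    have hmean : ∀ p ∈ regularSet (Ω.indicator f) (Ω.indicator D2) K m, ∀ r, 0 < r →
        r ≤ 2 * dist y x →
        ∫⁻ z in ball p r, ‖fderiv ℝ (fderiv ℝ g) z‖ₑ ≤ 16 * (m : ℝ≥0∞) * ENNReal.ofReal r ^ 2 := by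
      intro p hp r hr hr2
      have hrd : r ≤ d := by linarith [min_le_left (d / 2) (1 / (2 * (m * M + 1)))]
      have h1 := setLIntegral_normed_convolution_le_of_mean_bound (shrinkingBump n)
        (shrinkingBump_rOut_le n)
        (hD2i.integrable_indicator hΩ.measurableSet).aestronglyMeasurable hp.2.2 hr
      refine le_trans (le_of_eq ?_) h1
      refine setLIntegral_congr_fun measurableSet_ball fun z hz => ?_
      have hzW : z ∈ W := hdW p hp.1 (ball_subset_ball hrd hz)
      change ‖fderiv ℝ (fderiv ℝ g) z‖ₑ = _
      rw [hg, fderiv_fderiv_mollify hΩ hf hD hfi hDi hD2i hWo hn hzW]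
      rfl
    have ht := enorm_taylor_le_of_mean_bound (contDiff_infty.1 hgs 2) hR le_rfl
      (hmean x hx) (fun r hr hr2 => hmean y hy r hr (by linarith))
    have ht' : ‖g y - g x - fderiv ℝ g x (y - x)‖ ≤ M * dist y x ^ 2 := by
      have e : 34 * (16 * (m : ℝ≥0∞)) * ENNReal.ofReal (dist y x) ^ 2 =
          ENNReal.ofReal (M * dist y x ^ 2) := by
        rw [ENNReal.ofReal_mul (by positivity), ENNReal.ofReal_pow hR.le, hM,
          ENNReal.ofReal_mul (by norm_num), ENNReal.ofReal_mul (by norm_num),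
          ENNReal.ofReal_natCast, ENNReal.ofReal_ofNat, ENNReal.ofReal_ofNat]
      rw [e, ← ofReal_norm] at ht
      exact (ENNReal.ofReal_le_ofReal_iff (by positivity)).1 ht
    have hlow := hx.2.1 n hmn (y - x)
    have h5 : ‖fderiv ℝ g x (y - x)‖ ≤ ‖g y - g x‖ + M * dist y x ^ 2 := by
      calc ‖fderiv ℝ g x (y - x)‖ = ‖(g y - g x) - (g y - g x - fderiv ℝ g x (y - x))‖ := by
            congr 1; abel
        _ ≤ _ := (norm_sub_le _ _).trans (by gcongr)
    rw [dist_eq_norm] at h5 hlt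
    have h6 : m * M * ‖y - x‖ ≤ 1 / 2 := by
      have h7 : ‖y - x‖ ≤ 1 / (2 * (m * M + 1)) := hlt.le.trans (min_le_right _ _)
      rw [le_div_iff₀ (by positivity)] at h7
      nlinarith [norm_nonneg (y - x)]
    have h8 : ‖y - x‖ ≤ m * (‖g y - g x‖ + M * ‖y - x‖ ^ 2) := hlow.trans (by gcongr)
    nlinarith [norm_nonneg (y - x), mul_le_mul_of_nonneg_right h6 (norm_nonneg (y - x))]
  · right
    have h1 := hsep x hx.1 y hy.1 hge
    have h2 := hclose x hx.1
    have h3 := hclose y hy.1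
    rw [← dist_eq_norm]
    have h4 := dist_triangle4 (f y) (g y) (g x) (f x)
    rw [dist_comm (f y) (g y)] at h4
    linarith

lemma exists_smooth_approximation (hΩ : IsOpen Ω) (hΩn : Ω.Nonempty) (hΩfin : volume Ω < ⊤)
    (hf : HasWeakFDerivOn f D Ω) (hD : HasWeakFDerivOn D D2 Ω)
    (hfi : IntegrableOn f Ω) (hDi : IntegrableOn D Ω) (hD2i : IntegrableOn D2 Ω)
    (hfc : ContinuousOn f Ω) (hinj : InjOn f Ω) (hJ : ∀ᵐ x ∂volume.restrict Ω, (D x).det ≠ 0)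
    {ν : ℝ} (hν : 0 < ν) :
    ∃ (g : Plane → Plane) (G W : Set Plane), ContDiff ℝ ∞ g ∧ IsCompact G ∧ IsOpen W ∧ G ⊆ W ∧
      W ⊆ Ω ∧ volume Ω < volume G + ENNReal.ofReal ν ∧ InjOn g G ∧
      (∀ x ∈ G, (fderiv ℝ g x).det ≠ 0) ∧
      ∀ U ⊆ W, IsOpen U → w21Norm (fun x => f x - g x) U < ENNReal.ofReal ν := by
  have hνpos : 0 < ENNReal.ofReal ν := ENNReal.ofReal_pos.2 hν
  have hlt : volume Ω - ENNReal.ofReal ν < volume Ω :=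
    ENNReal.sub_lt_self hΩfin.ne (hΩ.measure_pos _ hΩn).ne' hνpos.ne'
  obtain ⟨K, hKΩ, hKc, hKlt⟩ := hΩ.exists_lt_isCompact hlt
  obtain ⟨m, hm⟩ := exists_lt_measure_regularSet hΩ hf hfi hDi hD2i hJ hKΩ hKlt
  set R := regularSet (Ω.indicator f) (Ω.indicator D2) K m with hR
  have hRK : R ⊆ K := fun x hx => hx.1
  have hclK : closure R ⊆ K := closure_minimal hRK hKc.isClosed
  obtain ⟨η, hη, hsep⟩ := eventually_separated_on_regularSet hΩ hf hD hfi hDi hD2i hfc hinj hKc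
    hKΩ m
  obtain ⟨W, hWo, hWΩ, ⟨d, hd, hdW⟩, hW⟩ := eventually_closedBall_rOut_subset hKc hΩ hKΩ
  have hlim := ((tendsto_setLIntegral_normed_convolution_sub tendsto_shrinkingBump_rOut
    (hfi.integrable_indicator hΩ.measurableSet) hΩfin.ne).add
    (tendsto_setLIntegral_normed_convolution_sub tendsto_shrinkingBump_rOut
    (hDi.integrable_indicator hΩ.measurableSet) hΩfin.ne)).add
    (tendsto_setLIntegral_normed_convolution_sub tendsto_shrinkingBump_rOut
    (hD2i.integrable_indicator hΩ.measurableSet) hΩfin.ne)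
  rw [add_zero, add_zero] at hlim
  obtain ⟨n, hn⟩ := ((hlim.eventually_lt_const hνpos).and
    (hW.and (hsep.and (eventually_ge_atTop m)))).exists
  obtain ⟨hnorm, hnW, hnsep, hmn⟩ := hn
  set g := mollify n (Ω.indicator f) with hg
  have hgs : ContDiff ℝ ∞ g :=
    contDiff_mollify n (hfi.integrable_indicator hΩ.measurableSet).locallyIntegrable
  have hg1 : ContDiff ℝ 1 g := hgs.of_le (by simp)
  have hg1' : ContDiff ℝ 1 (fderiv ℝ g) := (contDiff_infty.1 hgs 2).fderiv_right (by norm_num)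
  refine ⟨g, closure R, W, hgs, hKc.of_isClosed_subset isClosed_closure hclK, hWo, ?_, hWΩ, ?_, ?_,
    ?_, ?_⟩
  · exact fun x hx => hdW x (hclK hx) (mem_ball_self hd)
  · exact ENNReal.lt_add_of_sub_lt_right (.inl hΩfin.ne)
      (hm.trans_le (measure_mono subset_closure))
  -- The separation alternative is a closed condition on pairs, so it extends from `R` to its
  -- closure; equal images then force equal points.
  · have hcl : IsClosed {p : Plane × Plane | ‖p.2 - p.1‖ ≤ 2 * m * ‖g p.2 - g p.1‖ ∨
        η ≤ ‖g p.2 - g p.1‖} := by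
      have hgc := hgs.continuous
      have h1 : IsClosed {p : Plane × Plane | ‖p.2 - p.1‖ ≤ 2 * m * ‖g p.2 - g p.1‖} :=
        isClosed_le (by fun_prop) (by fun_prop)
      have h2 : IsClosed {p : Plane × Plane | η ≤ ‖g p.2 - g p.1‖} :=
        isClosed_le (by fun_prop) (by fun_prop)
      exact h1.union h2
    have hsub : closure R ×ˢ closure R ⊆ {p : Plane × Plane |
        ‖p.2 - p.1‖ ≤ 2 * m * ‖g p.2 - g p.1‖ ∨ η ≤ ‖g p.2 - g p.1‖} := by
      rw [← closure_prod_eq]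
      exact closure_minimal (fun p hp => hnsep p.1 hp.1 p.2 hp.2) hcl
    intro x hx y hy hxy
    rcases hsub (mk_mem_prod hx hy) with h | h
    · simp only [hxy, sub_self, norm_zero, mul_zero] at h
      exact (sub_eq_zero.1 (norm_le_zero_iff.1 h)).symm
    · simp only [hxy, sub_self, norm_zero] at h
      exact absurd h hη.not_ge
  · intro x hx
    have hcl : IsClosed {x : Plane | ∀ v, ‖v‖ ≤ m * ‖fderiv ℝ g x v‖} := by
      simp only [ofPred_forall]
      refine isClosed_iInter fun v => isClosed_le continuous_const ?_
      exact continuous_const.mul (hg1'.continuous.clm_apply continuous_const).norm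
    exact det_ne_zero_of_norm_le (closure_minimal (fun x hx => hx.2.1 n hmn) hcl hx)
  · intro U hUW hUo
    refine lt_of_le_of_lt ?_ hnorm
    have hUΩ := hUW.trans hWΩ
    -- The infimum is bounded by its value at this explicit pair of weak derivatives of `f - g`.
    refine (iInf₂_le (fun x => D x - fderiv ℝ g x)
      (fun x => D2 x - fderiv ℝ (fderiv ℝ g) x)).trans ?_
    refine (iInf₂_le ((hf.mono hUo hΩ hUΩ).sub (hg1.hasWeakFDerivOn hUo))
      ((hD.mono hUo hΩ hUΩ).sub (hg1'.hasWeakFDerivOn hUo))).trans ?_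
    refine add_le_add (add_le_add ?_ ?_) ?_
    · refine le_trans (le_of_eq ?_) (lintegral_mono_set hUΩ)
      refine setLIntegral_congr_fun hUo.measurableSet fun x hx => ?_
      simp only [indicator_of_mem (hUΩ hx)]
      rfl
    · refine le_trans (le_of_eq ?_) (lintegral_mono_set hUΩ)
      refine setLIntegral_congr_fun hUo.measurableSet fun x hx => ?_
      simp only [indicator_of_mem (hUΩ hx)]
      rw [hg, fderiv_mollify hΩ hf hfi hDi (hnW x (hUW hx))]
      rfl
    · refine le_trans (le_of_eq ?_) (lintegral_mono_set hUΩ)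
      refine setLIntegral_congr_fun hUo.measurableSet fun x hx => ?_
      simp only [indicator_of_mem (hUΩ hx)]
      rw [hg, fderiv_fderiv_mollify hΩ hf hD hfi hDi hD2i hWo hnW (hUW hx)]
      rfl

end Regular

/-! ### Locally finite coverings by squares -/

lemma isClosed_square (c : Plane) (r : ℝ) : IsClosed (square c r) := by
  have : square c r = ⋂ j : Fin 2, {x : Plane | |x j - c j| ≤ r} := by
    ext x; simp [square]
  rw [this]
  exact isClosed_iInter fun j => isClosed_le (by fun_prop) continuous_const

lemma exists_square_subset_of_mem_nhds {x : Plane} {s : Set Plane} (hs : s ∈ 𝓝 x) :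
    ∃ r : ℝ, 0 < r ∧ square x r ⊆ s := by
  obtain ⟨ε, hε, hsub⟩ := Metric.mem_nhds_iff.1 hs
  refine ⟨ε / 2, by positivity, fun y hy => hsub (mem_ball.2 ?_)⟩
  have h0 : |y 0 - x 0| ≤ ε / 2 := hy 0
  have h1 : |y 1 - x 1| ≤ ε / 2 := hy 1
  rw [EuclideanSpace.dist_eq, Real.sqrt_lt' hε, Fin.sum_univ_two, Real.dist_eq, Real.dist_eq]
  have := abs_nonneg (y 0 - x 0)
  have := abs_nonneg (y 1 - x 1)
  nlinarith

lemma square_mem_nhds (x : Plane) {r : ℝ} (hr : 0 < r) : square x r ∈ 𝓝 x := by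
  refine mem_of_superset (ball_mem_nhds x hr) fun y hy j => ?_
  have h2 := PiLp.norm_apply_le (y - x) j
  rw [← dist_eq_norm] at h2
  simpa using h2.trans (mem_ball.1 hy).le

lemma exists_finset_squares {C O : Set Plane} (hC : IsCompact C) (hO : IsOpen O) (hCO : C ⊆ O)
    (hne : O.Nonempty) :
    ∃ t : Finset (Plane × ℝ), t.Nonempty ∧ (∀ p ∈ t, 0 < p.2 ∧ square p.1 p.2 ⊆ O) ∧
      C ⊆ ⋃ p ∈ t, square p.1 p.2 := by
  classical
  obtain ⟨p₀, hp₀⟩ := hne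
  obtain ⟨r₀, hr₀, hsub₀⟩ := exists_square_subset_of_mem_nhds (hO.mem_nhds hp₀)
  have h : ∀ x : Plane, ∃ r : ℝ, x ∈ C → 0 < r ∧ square x r ⊆ O := fun x => by
    by_cases hx : x ∈ C
    · obtain ⟨r, hr⟩ := exists_square_subset_of_mem_nhds (hO.mem_nhds (hCO hx))
      exact ⟨r, fun _ => hr⟩
    · exact ⟨0, fun h => absurd h hx⟩
  choose r hr using h
  obtain ⟨t, ht, hcov⟩ := hC.elim_nhds_subcover (fun x => square x (r x))
    fun x hx => square_mem_nhds x (hr x hx).1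
  -- The extra square keeps the family nonempty even when `C` is empty.
  refine ⟨insert (p₀, r₀) (t.image fun x => (x, r x)), Finset.insert_nonempty _ _, ?_, ?_⟩
  · intro p hp
    rcases Finset.mem_insert.1 hp with rfl | hp
    · exact ⟨hr₀, hsub₀⟩
    · obtain ⟨x, hx, rfl⟩ := Finset.mem_image.1 hp
      exact hr x (ht x hx)
  · intro x hx
    obtain ⟨y, hy, hxy⟩ := mem_iUnion₂.1 (hcov hx)
    exact mem_iUnion₂.2 ⟨(y, r y), Finset.mem_insert_of_mem (Finset.mem_image_of_mem _ hy), hxy⟩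

lemma exists_compact_exhaustion {Ω : Set Plane} (hΩ : IsOpen Ω) :
    ∃ K : ℕ → Set Plane, (∀ n, IsCompact (K n)) ∧ (∀ n, K n ⊆ interior (K (n + 1))) ∧
      (∀ n, K n ⊆ Ω) ∧ Ω ⊆ ⋃ n, K n := by
  have : LocallyCompactSpace Ω := hΩ.locallyCompactSpace
  let E := CompactExhaustion.choice Ω
  refine ⟨fun n => Subtype.val '' E n, fun n => (E.isCompact n).image continuous_subtype_val,
    fun n => ?_, fun n => ?_, fun x hx => ?_⟩
  · refine (image_mono (E.subset_interior_succ n)).trans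
      (interior_maximal (image_mono interior_subset) ?_)
    exact hΩ.isOpenMap_subtype_val _ isOpen_interior
  · rintro _ ⟨x, -, rfl⟩; exact x.2
  · have : (⟨x, hx⟩ : Ω) ∈ ⋃ n, E n := by rw [E.iUnion_eq]; trivial
    obtain ⟨n, hn⟩ := mem_iUnion.1 this
    exact mem_iUnion.2 ⟨n, ⟨x, hx⟩, hn, rfl⟩

/-- Each compact layer of `Ω \ U` is covered by finitely many squares that avoid an earlier set of
the exhaustion. All squares lie in one open set of measure below `a`, so overlaps do no harm. -/
lemma exists_locallyFinite_squares {Ω U : Set Plane} (hΩ : IsOpen Ω) (hΩn : Ω.Nonempty)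
    (hΩfin : volume Ω < ⊤) (hU : IsOpen U) {a : ℝ≥0∞} (ha : volume (Ω \ U) < a) :
    ∃ (c : ℕ → Plane) (r : ℕ → ℝ), (∀ i, 0 < r i) ∧
      (∀ K : Set Plane, IsCompact K → K ⊆ Ω → {i | (square (c i) (r i) ∩ K).Nonempty}.Finite) ∧
      volume (⋃ i, square (c i) (r i)) < a ∧ Ω \ U ⊆ ⋃ i, square (c i) (r i) := by
  obtain ⟨K, hKc, hKint, hKΩ, hcov⟩ := exists_compact_exhaustion hΩ
  have hKmono : Monotone K := monotone_nat_of_le_succ fun n => (hKint n).trans interior_subset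
  -- If `Ω` were compact it would be clopen and nonempty, hence the whole plane, of infinite area.
  -- The resulting points `p n`, a null set, guarantee a square in every layer and thus an infinite
  -- index set.
  have hout : ∀ n, (Ω \ K n).Nonempty := by
    intro n
    by_contra h
    have hsub : Ω ⊆ K n := sdiff_eq_empty.1 (not_nonempty_iff_eq_empty.1 h)
    have heq : Ω = K n := hsub.antisymm (hKΩ n)
    have hclopen : IsClopen Ω := ⟨heq ▸ (hKc n).isClosed, hΩ⟩
    rcases isClopen_iff.1 hclopen with h | h
    · exact hΩn.ne_empty h
    · rw [h, measure_univ_of_isAddLeftInvariant] at hΩfin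
      exact lt_irrefl _ hΩfin
  choose p hp using hout
  obtain ⟨V, hFV, hVo, hVa⟩ : ∃ V ⊇ (Ω \ U) ∪ range p, IsOpen V ∧ volume V < a := by
    refine exists_isOpen_lt_of_lt _ _ ?_
    exact (measure_union_le _ _).trans_lt (by rwa [(countable_range p).measure_zero, add_zero])
  -- the layer between `K n` and `K (n + 2)` is used to cover `K (n + 2) \ interior (K (n + 1))`
  let O : ℕ → Set Plane := fun n => V ∩ (Ω \ K n)
  have hOo : ∀ n, IsOpen (O n) := fun n => hVo.inter (hΩ.sdiff (hKc n).isClosed)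
  have hOn : ∀ n, (O n).Nonempty := fun n => ⟨p n, hFV (.inr (mem_range_self n)), hp n⟩
  have key : ∀ n, ∃ t : Finset (Plane × ℝ), t.Nonempty ∧
      (∀ q ∈ t, 0 < q.2 ∧ square q.1 q.2 ⊆ O n) ∧
      (K (n + 2) \ interior (K (n + 1))) \ U ⊆ ⋃ q ∈ t, square q.1 q.2 := fun n => by
    refine exists_finset_squares (((hKc _).diff isOpen_interior).diff hU) (hOo n) ?_ (hOn n)
    rintro x ⟨⟨hx1, hx2⟩, hx3⟩
    exact ⟨hFV (.inl ⟨hKΩ _ hx1, hx3⟩), hKΩ _ hx1, fun hx => hx2 (hKint n hx)⟩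
  choose t htn htO htcov using key
  -- The layers start outside the interior of `K 1`, so the core needs its own finite family.
  obtain ⟨s, hsV, hscov⟩ : ∃ s : Finset (Plane × ℝ),
      (∀ q ∈ s, 0 < q.2 ∧ square q.1 q.2 ⊆ V ∩ Ω) ∧ K 1 \ U ⊆ ⋃ q ∈ s, square q.1 q.2 := by
    obtain ⟨s, -, h1, h2⟩ := exists_finset_squares ((hKc 1).diff hU) (hVo.inter hΩ)
      (fun x hx => ⟨hFV (.inl ⟨hKΩ _ hx.1, hx.2⟩), hKΩ _ hx.1⟩)
      ⟨p 0, hFV (.inr (mem_range_self 0)), (hp 0).1⟩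
    exact ⟨s, h1, h2⟩
  let ι := s ⊕ Σ n, t n
  have : Infinite (Σ n, t n) := by
    have : ∀ n, Nonempty (t n) := fun n => (htn n).to_subtype
    exact Infinite.of_injective (fun n : ℕ => (⟨n, Classical.arbitrary _⟩ : Σ n, t n))
      fun a b h => congrArg Sigma.fst h
  have : Infinite ι := inferInstanceAs (Infinite (s ⊕ Σ n, t n))
  have : Countable ι := inferInstanceAs (Countable (s ⊕ Σ n, t n))
  obtain ⟨e⟩ : Nonempty (ℕ ≃ ι) := nonempty_equiv_of_countable
  let q : ι → Plane × ℝ := Sum.elim (fun x => x.1) (fun x => x.2.1)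
  have hq : ∀ i, 0 < (q i).2 ∧ square (q i).1 (q i).2 ⊆ V := by
    rintro (x | ⟨n, x⟩)
    · exact ⟨(hsV x.1 x.2).1, (hsV x.1 x.2).2.trans inter_subset_left⟩
    · exact ⟨(htO n x.1 x.2).1, (htO n x.1 x.2).2.trans inter_subset_left⟩
  refine ⟨fun i => (q (e i)).1, fun i => (q (e i)).2, fun i => (hq _).1, fun L hL hLΩ => ?_, ?_, ?_⟩
  · obtain ⟨m, hm⟩ : ∃ m, L ⊆ K m := by
      obtain ⟨T, hT⟩ := hL.elim_finite_subcover (fun n => interior (K (n + 1)))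
        (fun n => isOpen_interior) ((hLΩ.trans hcov).trans (iUnion_mono hKint))
      refine ⟨T.sup id + 1, fun x hx => ?_⟩
      obtain ⟨n, hn, hxn⟩ := mem_iUnion₂.1 (hT hx)
      exact hKmono (Nat.succ_le_succ (Finset.le_sup (f := id) hn)) (interior_subset hxn)
    -- Squares of layer `n` avoid `K n`, so a set inside `K m` can meet only the core family and the
    -- layers `n < m`.
    have hfin : (range (Sum.inl : s → ι) ∪ ⋃ n ∈ Finset.range m,
        range (fun x : t n => (Sum.inr ⟨n, x⟩ : ι))).Finite :=
      (finite_range _).union ((Finset.finite_toSet _).biUnion fun n _ => finite_range _)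
    refine (hfin.preimage e.injective.injOn).subset ?_
    rintro i ⟨z, hz, hzL⟩
    rw [mem_preimage]
    change z ∈ square (q (e i)).1 (q (e i)).2 at hz
    rcases h : e i with x | ⟨n, x⟩
    · exact .inl ⟨x, rfl⟩
    · rw [h] at hz
      have hzO := (htO n x.1 x.2).2 hz
      refine .inr (mem_iUnion₂.2 ⟨n, Finset.mem_coe.2 (Finset.mem_range.2 ?_), x, rfl⟩)
      by_contra! hmn
      exact hzO.2.2 (hKmono hmn (hm hzL))
  · exact (measure_mono (iUnion_subset fun i => (hq _).2)).trans_lt hVa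
  · rintro x ⟨hxΩ, hxU⟩
    suffices h : ∃ i : ι, x ∈ square (q i).1 (q i).2 by
      obtain ⟨i, hi⟩ := h
      refine mem_iUnion.2 ⟨e.symm i, ?_⟩
      simpa using hi
    by_cases hx1 : x ∈ K 1
    · obtain ⟨y, hy, hxy⟩ := mem_iUnion₂.1 (hscov ⟨hx1, hxU⟩)
      exact ⟨.inl ⟨y, hy⟩, hxy⟩
    · have hex : ∃ n, x ∈ K (n + 2) := by
        obtain ⟨n, hn⟩ := mem_iUnion.1 (hcov hxΩ)
        exact ⟨n, hKmono (by omega) hn⟩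
      classical
      have hn := Nat.find_spec hex
      set n := Nat.find hex with hndef
      have hn' : x ∉ K (n + 1) := by
        rcases Nat.eq_zero_or_pos n with h0 | h0
        · rwa [h0]
        · have := Nat.find_min hex (m := n - 1) (by omega)
          rwa [show n - 1 + 2 = n + 1 by omega] at this
      obtain ⟨y, hy, hxy⟩ := mem_iUnion₂.1
        (htcov n ⟨⟨hn, fun h => hn' (interior_subset h)⟩, hxU⟩)
      exact ⟨.inr ⟨n, ⟨y, hy⟩⟩, hxy⟩

lemma isOpen_diff_iUnion_squares {Ω : Set Plane} (hΩ : IsOpen Ω) {c : ℕ → Plane} {r : ℕ → ℝ}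
    (h : ∀ K : Set Plane, IsCompact K → K ⊆ Ω → {i | (square (c i) (r i) ∩ K).Nonempty}.Finite) :
    IsOpen (Ω \ ⋃ i, square (c i) (r i)) := by
  rw [isOpen_iff_mem_nhds]
  rintro x ⟨hxΩ, hxQ⟩
  obtain ⟨L, hLx, hLΩ, hLc⟩ := local_compact_nhds (hΩ.mem_nhds hxΩ)
  have hfin := h L hLc hLΩ
  have hcl : IsClosed (⋃ i ∈ {i | (square (c i) (r i) ∩ L).Nonempty}, square (c i) (r i)) :=
    hfin.isClosed_biUnion fun i _ => isClosed_square _ _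
  have hx : x ∉ ⋃ i ∈ {i | (square (c i) (r i) ∩ L).Nonempty}, square (c i) (r i) := fun hx =>
    hxQ (iUnion₂_subset (fun i _ => subset_iUnion (fun i => square (c i) (r i)) i) hx)
  filter_upwards [hLx, hcl.isOpen_compl.mem_nhds hx] with y hyL hyQ
  refine ⟨hLΩ hyL, fun hy => hyQ ?_⟩
  obtain ⟨i, hi⟩ := mem_iUnion.1 hy
  exact mem_iUnion₂.2 ⟨i, ⟨y, hi, hyL⟩, hi⟩

/-! ### From injectivity on a compact set to a diffeomorphism -/

section LocalInverse

variable {E : Type*} [NormedAddCommGroup E] [NormedSpace ℝ E] [FiniteDimensional ℝ E]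

lemma exists_hasStrictFDerivAt_equiv {g : E → E} (hg : ContDiff ℝ ∞ g) {x : E}
    (hx : (fderiv ℝ g x).det ≠ 0) :
    ∃ A : E ≃L[ℝ] E, HasStrictFDerivAt g (A : E →L[ℝ] E) x := by
  refine ⟨(fderiv ℝ g x).toContinuousLinearEquivOfDetNeZero hx, ?_⟩
  exact hg.contDiffAt.hasStrictFDerivAt (by simp)

/-- The inverse function theorem gives local injectivity at each point of `G`; with injectivity on
the compact `G`, this extends to a neighbourhood. Nonvanishing of the determinant is an open
condition. -/
lemma exists_open_injOn_nhd {g : E → E} (hg : ContDiff ℝ ∞ g) {G W : Set E} (hG : IsCompact G)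
    (hW : IsOpen W) (hGW : G ⊆ W) (hinj : InjOn g G) (hdet : ∀ x ∈ G, (fderiv ℝ g x).det ≠ 0) :
    ∃ U, IsOpen U ∧ G ⊆ U ∧ U ⊆ W ∧ InjOn g U ∧ ∀ x ∈ U, (fderiv ℝ g x).det ≠ 0 := by
  have : CompleteSpace E := FiniteDimensional.complete ℝ E
  obtain ⟨t, ht, htinj⟩ := hinj.exists_mem_nhdsSet hG (fun x _ => hg.continuous.continuousAt)
    fun x hx => by
      obtain ⟨A, hA⟩ := exists_hasStrictFDerivAt_equiv hg (hdet x hx)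
      exact ⟨_, (hA.toOpenPartialHomeomorph g).open_source.mem_nhds
        hA.mem_toOpenPartialHomeomorph_source, (hA.toOpenPartialHomeomorph g).injOn⟩
  obtain ⟨U, hUo, hGU, hUt⟩ := mem_nhdsSet_iff_exists.1 ht
  have hdo : IsOpen {x | (fderiv ℝ g x).det ≠ 0} :=
    isOpen_ne_fun (continuous_det.comp (hg.continuous_fderiv (by simp))) continuous_const
  exact ⟨U ∩ (W ∩ {x | (fderiv ℝ g x).det ≠ 0}), hUo.inter (hW.inter hdo),
    fun x hx => ⟨hGU hx, hGW hx, hdet x hx⟩, fun x hx => hx.2.1,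
    htinj.mono fun x hx => hUt hx.1, fun x hx => hx.2.2⟩

lemma exists_openPartialHomeomorph_of_injOn {g : E → E} (hg : ContDiff ℝ ∞ g) {S : Set E}
    (hS : IsOpen S) (hinj : InjOn g S) (hdet : ∀ x ∈ S, (fderiv ℝ g x).det ≠ 0) :
    ∃ e : OpenPartialHomeomorph E E, e.source = S ∧ (∀ x, e x = g x) ∧
      ContDiffOn ℝ ∞ e.symm e.target := by
  have : CompleteSpace E := FiniteDimensional.complete ℝ E
  classical
  have hopen : IsOpenMap (S.domRestrict g) := by
    rw [isOpenMap_iff_nhds_le]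
    rintro ⟨x, hx⟩
    obtain ⟨A, hA⟩ := exists_hasStrictFDerivAt_equiv hg (hdet x hx)
    have h1 := hA.map_nhds_eq_of_equiv
    change 𝓝 (g x) ≤ map (g ∘ Subtype.val) (𝓝 _)
    rw [← Filter.map_map, map_nhds_subtype_coe_eq_nhds hx (hS.mem_nhds hx), h1]
  let e : OpenPartialHomeomorph E E :=
    OpenPartialHomeomorph.ofContinuousOpenRestrict (hinj.toPartialEquiv g S)
      hg.continuous.continuousOn hopen hS
  have hes : e.source = S := rfl
  refine ⟨e, hes, fun x => rfl, fun y hy => ContDiffAt.contDiffWithinAt ?_⟩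
  have hxS : e.symm y ∈ S := e.map_target hy
  obtain ⟨A, hA⟩ := exists_hasStrictFDerivAt_equiv hg (hdet _ hxS)
  exact e.contDiffAt_symm hy hA.hasFDerivAt hg.contDiffAt

end LocalInverse

/-- The homeomorphism `f` of `Ω` onto its image is a topological embedding of `Ω`; the
`C^∞` diffeomorphism `g` of the open set `Ω ∖ ⋃ Q_i` onto an open set is an
`OpenPartialHomeomorph` with that source which is smooth together with its inverse. -/
theorem theorem1p2 (Ω : Set Plane) (hΩ_open : IsOpen Ω) (hΩ_conn : IsConnected Ω)
    (hΩ_fin : volume Ω < ⊤)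
    (f : Plane → Plane) (hf_homeo : IsEmbedding (Ω.domRestrict f)) (hf : MemW21 f Ω)
    (Df : Plane → Plane →L[ℝ] Plane) (hDf : HasWeakFDerivOn f Df Ω)
    (hJ : ∀ᵐ x ∂volume.restrict Ω, 0 < (Df x).det)
    (ν : ℝ) (hν : 0 < ν) :
    ∃ (c : ℕ → Plane) (r : ℕ → ℝ),
      (∀ i, 0 < r i) ∧
      (∀ K : Set Plane, IsCompact K → K ⊆ Ω → {i | (square (c i) (r i) ∩ K).Nonempty}.Finite) ∧
      volume (⋃ i, square (c i) (r i)) < ENNReal.ofReal ν ∧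
      ∃ g : OpenPartialHomeomorph Plane Plane,
        g.source = Ω \ ⋃ i, square (c i) (r i) ∧
        ContDiffOn ℝ ∞ g g.source ∧ ContDiffOn ℝ ∞ g.symm g.target ∧
        w21Norm (fun x => f x - g x) (Ω \ ⋃ i, square (c i) (r i)) < ENNReal.ofReal ν := by
  obtain ⟨D, D2, hD, hD2, hfi, hDi, hD2i⟩ := hf
  -- Uniqueness of weak gradients transfers the Jacobian condition from `Df` to the `D` that comes
  -- with a weak derivative `D2`.
  have hJ' : ∀ᵐ x ∂volume.restrict Ω, (D x).det ≠ 0 := by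
    filter_upwards [hJ, hDf.ae_eq hΩ_open hD] with x hx hxD
    rw [← hxD]
    exact hx.ne'
  have hfc : ContinuousOn f Ω := continuousOn_iff_continuous_domRestrict.2 hf_homeo.continuous
  have hfinj : InjOn f Ω := injOn_iff_injective.2 hf_homeo.injective
  obtain ⟨g, G, W, hg, hG, hW, hGW, hWΩ, hvol, hinj, hdet, hnorm⟩ :=
    exists_smooth_approximation hΩ_open hΩ_conn.nonempty hΩ_fin hD hD2 hfi hDi hD2i hfc hfinj hJ' hν
  obtain ⟨U, hU, hGU, hUW, hUinj, hUdet⟩ := exists_open_injOn_nhd hg hG hW hGW hinj hdet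
  have hUvol : volume (Ω \ U) < ENNReal.ofReal ν := by
    have hUΩ : U ⊆ Ω := hUW.trans hWΩ
    rw [measure_sdiff hUΩ hU.measurableSet.nullMeasurableSet (measure_mono hUΩ |>.trans_lt hΩ_fin).ne]
    refine ENNReal.sub_lt_of_lt_add (measure_mono hUΩ) ?_
    rw [add_comm]
    exact hvol.trans_le (add_le_add (measure_mono hGU) le_rfl)
  obtain ⟨c, r, hr, hfin, hsmall, hcov⟩ :=
    exists_locallyFinite_squares hΩ_open hΩ_conn.nonempty hΩ_fin hU hUvol
  have hSU : Ω \ ⋃ i, square (c i) (r i) ⊆ U := fun x hx => by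
    by_contra hxU
    exact hx.2 (hcov ⟨hx.1, hxU⟩)
  have hSo := isOpen_diff_iUnion_squares hΩ_open hfin
  obtain ⟨e, hes, heg, hesymm⟩ := exists_openPartialHomeomorph_of_injOn hg hSo (hUinj.mono hSU)
    fun x hx => hUdet x (hSU hx)
  refine ⟨c, r, hr, hfin, hsmall, e, hes, ?_, hesymm, ?_⟩
  · exact hg.contDiffOn.congr fun x _ => heg x
  · simp only [heg]
    exact hnorm _ (hSU.trans hUW) hSo
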